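/- Let $k$ be a field and $n\ge 1$. For a ring $A$ with a derivation $\delta$, let $A((\partial^{-1}))$ be the set of formal expressions $\sum_{i\le N}a_i\partial^i$ ($N\in\mathbf Z$, $a_i\in A$) with coefficientwise addition and the product $$\Bigl(\sum_i a_i\partial^i\Bigr)\Bigl(\sum_j b_j\partial^j\Bigr)=\sum_{i,j\in\mathbf Z;\,s\ge 0}\binom{i}{s}\,a_i\,\delta^s(b_j)\,\partial^{\,i+j-s}.$$ Let $K=k((x_1))\dots((x_n))$ be the field of iterated Laurent series and put $$P=K((\partial_1^{-1}))\dots((\partial_n^{-1})),\qquad E=k[[x_1,\dots,x_n]]((\partial_1^{-1}))\dots((\partial_n^{-1}))\subset P,$$ where $\partial_i$ acts as $\partial/\partial x_i$, extended to the iterated rings coefficientwise. If $L=\sum_{i\le m}a_i\partial_n^i$ with $a_m\ne 0$, put $\mathrm{ord}(L)=m$, and let the highest term of $L$ be (by induction) the highest term of $a_m$ times $\partial_n^m$. It has the form $f\,\partial_1^{m_1}\cdots\partial_n^{m_n}$ with $0\ne f\in K$; put $\nu(L)=(m_1,\dots,m_n)\in\mathbf Z^n$ and call $f$ the leading coefficient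 of $L$. Put $\mathrm{ord}(0)=\nu(0)=-\infty$ and let $0$ have leading coefficient $0$. Order $\mathbf Z^n$ lexicographically with the last coordinate $m_n$ (the exponent of the outermost variable $\partial_n$) compared first. Then: i) $P$ is an associative skew-field and $E$ is a subring of $P$; an operator $L\in E$ is invertible in $E$ if and only if its leading coefficient is an invertible element of $k[[x_1,\dots,x_n]]$. ii) $\mathrm{ord}(LM)=\mathrm{ord}(L)+\mathrm{ord}(M)$ and $\mathrm{ord}(L+M)\le\max(\mathrm{ord}(L),\mathrm{ord}(M))$ for all $L,M\in P$. iii) $\nu(LM)=\nu(L)+\nu(M)$ and $\nu(L+M)\le\max(\nu(L),\nu(M))$ for all $L,M\in P$. iv) Let $m\in\mathbf N$ be nonzero in $k$ (that is, $m\geq 1$ and $m$ is prime to $\mathrm{char}(k)$ if $\mathrm{char}(k)>0$), and let $L\ne 0$ be an operator with all components of $\nu(L)$ divisible by $m$ and with leading coefficient $f$. If $L\in P$ and $f$ is an $m$-th power in $K$, then there is $M\in P$ with $M^m=L$, and the $m$-th roots of $L$ in $P$ are exactly the operators $\zeta M$ with $\zeta\in k$, $\zeta^m=1$. If $L\in E$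 and $f=g^m$ with $g\in k[[x_1,\dots,x_n]]$, then for any $M\in E$ with $M^m=L$ the $m$-th roots of $L$ in $E$ are exactly the operators $\zeta M$ with $\zeta\in k$, $\zeta^m=1$; and such an $M\in E$ exists if moreover $g$ is invertible in $k[[x_1,\dots,x_n]]$. -/

import Mathlib

universe u

noncomputable section

namespace PsiDO

/-! ## Formal pseudo-differential operators over a ring `A` with an operator `δ`

`A` is not assumed commutative.  Only the distributive laws of `A` and the additivity of `δ`
are used to write down the Leibniz product. -/

/-- `A((∂⁻¹))`: formal expressions `∑ aᵢ ∂ⁱ`, `i ∈ ℤ`, `aᵢ ∈ A`, with `aᵢ = 0` for all large `i`.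
The map `δ : A → A` is the one by which `∂` acts on `A`; it enters the product only. -/
@[ext]
structure Op (A : Type u) [NonUnitalNonAssocRing A] (δ : A →+ A) : Type u where
  /-- the coefficient of `∂ⁱ`, written to the left of `∂ⁱ` -/
  coeff : ℤ → A
  /-- only finitely many positive powers of `∂` occur -/
  bdd : ∃ N : ℤ, ∀ i : ℤ, N < i → coeff i = 0

namespace Op

variable {A : Type u} [NonUnitalNonAssocRing A] {δ : A →+ A}

instance : Zero (Op A δ) := ⟨⟨fun _ => 0, 0, fun _ _ => rfl⟩⟩

instance : Add (Op A δ) :=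
  ⟨fun L M => ⟨fun i => L.coeff i + M.coeff i, by
    obtain ⟨N₁, h₁⟩ := L.bdd
    obtain ⟨N₂, h₂⟩ := M.bdd
    refine ⟨max N₁ N₂, fun i hi => ?_⟩
    rw [h₁ i (lt_of_le_of_lt (le_max_left _ _) hi), h₂ i (lt_of_le_of_lt (le_max_right _ _) hi),
      add_zero]⟩⟩

instance : Neg (Op A δ) :=
  ⟨fun L => ⟨fun i => - L.coeff i, by
    obtain ⟨N₁, h₁⟩ := L.bdd
    exact ⟨N₁, fun i hi => by rw [h₁ i hi, neg_zero]⟩⟩⟩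

instance : AddCommGroup (Op A δ) where
  add_assoc a b c := Op.ext (funext fun i => add_assoc (a.coeff i) (b.coeff i) (c.coeff i))
  zero_add a := Op.ext (funext fun i => zero_add (a.coeff i))
  add_zero a := Op.ext (funext fun i => add_zero (a.coeff i))
  neg_add_cancel a := Op.ext (funext fun i => neg_add_cancel (a.coeff i))
  add_comm a b := Op.ext (funext fun i => add_comm (a.coeff i) (b.coeff i))
  nsmul := nsmulRec
  zsmul := zsmulRec

@[simp] theorem zero_coeff (i : ℤ) : (0 : Op A δ).coeff i = 0 := rfl

@[simp] theorem add_coeff (L M : Op A δ) (i : ℤ) :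
    (L + M).coeff i = L.coeff i + M.coeff i := rfl

/-- The term with `∂ˡ` in `(aᵢ ∂ⁱ) (bⱼ ∂ʲ)`, where `p = (i, s)` and `j = l - i + s`, that is
`l = i + j - s`: it is `C(i, s) aᵢ δˢ(bⱼ)`. -/
def mulTerm (L M : Op A δ) (l : ℤ) (p : ℤ × ℕ) : A :=
  Ring.choose p.1 p.2 • (L.coeff p.1 * (δ^[p.2]) (M.coeff (l - p.1 + p.2)))

theorem iterate_delta_zero (s : ℕ) : (δ^[s]) 0 = 0 :=
  Function.iterate_fixed (map_zero δ) s

theorem iterate_delta_add (s : ℕ) (x y : A) : (δ^[s]) (x + y) = (δ^[s]) x + (δ^[s]) y := by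
  induction s generalizing x y with
  | zero => rfl
  | succ s ih => simp [Function.iterate_succ_apply, ih]

theorem mulTerm_ne_zero {L M : Op A δ} {N₁ N₂ : ℤ} (h₁ : ∀ i, N₁ < i → L.coeff i = 0)
    (h₂ : ∀ i, N₂ < i → M.coeff i = 0) {l : ℤ} {p : ℤ × ℕ} (h : mulTerm L M l p ≠ 0) :
    p.1 ≤ N₁ ∧ l - p.1 + p.2 ≤ N₂ := by
  constructor
  · by_contra hc
    exact h (by rw [mulTerm, h₁ _ (not_le.1 hc), zero_mul, smul_zero])
  · by_contra hc
    exact h (by rw [mulTerm, h₂ _ (not_le.1 hc), iterate_delta_zero, mul_zero, smul_zero])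

/-- For every `l` only finitely many terms of the product contribute to the coefficient of `∂ˡ`. -/
theorem mulTerm_finite (L M : Op A δ) (l : ℤ) : (Function.support (mulTerm L M l)).Finite := by
  obtain ⟨N₁, h₁⟩ := L.bdd
  obtain ⟨N₂, h₂⟩ := M.bdd
  refine ((Set.finite_Icc (l - N₂) N₁).prod (Set.finite_Iic (N₁ + N₂ - l).toNat)).subset ?_
  rintro ⟨i, s⟩ hp
  have := mulTerm_ne_zero h₁ h₂ (Function.mem_support.1 hp)
  simp only [Set.mem_prod, Set.mem_Icc, Set.mem_Iic] at this ⊢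
  omega

/-- The Leibniz product
`(∑ aᵢ ∂ⁱ) (∑ bⱼ ∂ʲ) = ∑ C(i, s) aᵢ δˢ(bⱼ) ∂^(i + j - s)`, the sum being over `i, j ∈ ℤ`, `s ≥ 0`
(each coefficient is a finite sum). -/
instance : Mul (Op A δ) :=
  ⟨fun L M => ⟨fun l => ∑ᶠ p : ℤ × ℕ, mulTerm L M l p, by
    obtain ⟨N₁, h₁⟩ := L.bdd
    obtain ⟨N₂, h₂⟩ := M.bdd
    refine ⟨N₁ + N₂, fun l hl => finsum_eq_zero_of_forall_eq_zero fun p => ?_⟩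
    by_contra hp
    have := mulTerm_ne_zero h₁ h₂ hp
    omega⟩⟩

theorem mul_coeff (L M : Op A δ) (l : ℤ) :
    (L * M).coeff l = ∑ᶠ p : ℤ × ℕ, mulTerm L M l p := rfl

instance : NonUnitalNonAssocRing (Op A δ) where
  left_distrib a b c := by
    ext l
    simp only [mul_coeff, add_coeff]
    rw [← finsum_add_distrib (mulTerm_finite a b l) (mulTerm_finite a c l)]
    exact finsum_congr fun p => by
      simp only [mulTerm, add_coeff, iterate_delta_add, mul_add, smul_add]
  right_distrib a b c := by
    ext l
    simp only [mul_coeff, add_coeff]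
    rw [← finsum_add_distrib (mulTerm_finite a c l) (mulTerm_finite b c l)]
    exact finsum_congr fun p => by
      simp only [mulTerm, add_coeff, add_mul, smul_add]
  zero_mul a := by
    ext l
    exact finsum_eq_zero_of_forall_eq_zero fun p => by
      simp only [mulTerm, zero_coeff, zero_mul, smul_zero]
  mul_zero a := by
    ext l
    exact finsum_eq_zero_of_forall_eq_zero fun p => by
      simp only [mulTerm, zero_coeff, iterate_delta_zero, mul_zero, smul_zero]

/-- The operator `a = a ∂⁰` for `a ∈ A`. -/
def const (a : A) : Op A δ :=
  ⟨fun i => if i = 0 then a else 0, 0, fun i hi => if_neg (by omega)⟩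

/-- An additive map of `A` acting on the coefficients of operators. -/
def mapCoeff (e : A →+ A) : Op A δ →+ Op A δ where
  toFun L := ⟨fun i => e (L.coeff i), by
    obtain ⟨N, h⟩ := L.bdd
    exact ⟨N, fun i hi => by rw [h i hi, map_zero]⟩⟩
  map_zero' := Op.ext (funext fun _ => map_zero e)
  map_add' _ _ := Op.ext (funext fun _ => map_add e _ _)

/-- The largest `m` with `aₘ ≠ 0` (used only for nonzero operators; it is `0` for the zero
operator). -/
def top (L : Op A δ) : ℤ := sSup {i : ℤ | L.coeff i ≠ 0}

end Op

/-! ## Iterated Laurent series `K = k((x₁))…((xₙ))` -/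

/-- A field, bundled, to iterate the formation of Laurent series. -/
structure BundledField : Type (u + 1) where
  /-- the underlying type -/
  carrier : Type u
  /-- the field structure -/
  [field : Field carrier]

/-- `k((x₁))…((xₙ))` with its field structure: the field of Laurent series in `xₙ` over
`k((x₁))…((xₙ₋₁))`. -/
def laurentField (k : Type u) [Field k] : ℕ → BundledField.{u}
  | 0 => ⟨k⟩
  | n + 1 =>
    letI := (laurentField k n).field
    ⟨LaurentSeries (laurentField k n).carrier⟩

/-- `K = k((x₁))…((xₙ))`. -/
def K (k : Type u) [Field k] (n : ℕ) : Type u := (laurentField k n).carrier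

instance (k : Type u) [Field k] (n : ℕ) : Field (K k n) := (laurentField k n).field

/-- The embedding of the constants `k → k((x₁))…((xₙ))`. -/
def constK (k : Type u) [Field k] : (n : ℕ) → k → K k n
  | 0, c => c
  | n + 1, c => (HahnSeries.C (constK k n c) : LaurentSeries (K k n))

/-- `partialX k n i` is the derivation `∂/∂x_{i+1}` of `k((x₁))…((xₙ))` for `i < n` (the variables
are numbered from `0` here).  On `k((x₁))…((xₙ₊₁))` the derivation with respect to the last
variable is the usual one of Laurent series, the others act on the coefficients.
For `i ≥ n` it is zero. -/
def partialX (k : Type u) [Field k] : (n : ℕ) → ℕ → (K k n →+ K k n)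
  | 0, _ => 0
  | n + 1, i =>
    if i = n then
      ((LaurentSeries.hasseDeriv (K k n) 1 :
        LaurentSeries (K k n) →ₗ[K k n] LaurentSeries (K k n)).toAddMonoidHom :
        LaurentSeries (K k n) →+ LaurentSeries (K k n))
    else
      ({ toFun := fun f => HahnSeries.map f (partialX k n i)
         map_zero' := by ext; simp
         map_add' := fun f g => by ext; simp } :
        LaurentSeries (K k n) →+ LaurentSeries (K k n))

/-- The embedding `k[[x₁, …, xₙ]] → k((x₁))…((xₙ))`: a power series in `x₁, …, xₙ₊₁` is regarded
as a power series in `xₙ₊₁` whose coefficients are power series in `x₁, …, xₙ`. -/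
def taylor (k : Type u) [Field k] : (n : ℕ) → MvPowerSeries (Fin n) k → K k n
  | 0, φ => MvPowerSeries.coeff 0 φ
  | n + 1, φ =>
    (HahnSeries.ofPowerSeries ℤ (K k n) (PowerSeries.mk fun j : ℕ =>
      taylor k n fun α : Fin n →₀ ℕ =>
        MvPowerSeries.coeff (Finsupp.equivFunOnFinite.symm (Fin.snoc (α := fun _ => ℕ) α j)) φ) :
      LaurentSeries (K k n))

/-! ## The rings `P` and `E` -/

/-- A distributive ring (associativity is not built in) together with an element `1` and
additive operators `d 0, d 1, …`, bundled, to iterate the formation of `A((∂⁻¹))`. -/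
structure BundledRing : Type (u + 1) where
  /-- the underlying type -/
  carrier : Type u
  /-- addition and multiplication -/
  [ring : NonUnitalNonAssocRing carrier]
  /-- the unit -/
  [one : One carrier]
  /-- the operators -/
  d : ℕ → carrier →+ carrier

attribute [instance] BundledRing.ring BundledRing.one

/-- From `A` to `A((∂⁻¹))`, where `∂` acts on `A` by `d r`; all the `d i` are extended to
`A((∂⁻¹))` by acting on the coefficients. -/
def extend (A : BundledRing.{u}) (r : ℕ) : BundledRing.{u} :=
  letI : One (Op A.carrier (A.d r)) := ⟨Op.const 1⟩
  { carrier := Op A.carrier (A.d r)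
    d := fun i => Op.mapCoeff (A.d i) }

/-- `k((x₁))…((xₙ))((∂₁⁻¹))…((∂ᵣ⁻¹))`, where `∂ᵢ` acts as `∂/∂xᵢ`. -/
def tower (k : Type u) [Field k] (n : ℕ) : ℕ → BundledRing.{u}
  | 0 => { carrier := K k n, d := partialX k n }
  | r + 1 => extend (tower k n r) r

/-- The underlying type of `k((x₁))…((xₙ))((∂₁⁻¹))…((∂ᵣ⁻¹))`. -/
abbrev T (k : Type u) [Field k] (n r : ℕ) : Type u := (tower k n r).carrier

/-- `P = k((x₁))…((xₙ))((∂₁⁻¹))…((∂ₙ⁻¹))`. -/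
abbrev P (k : Type u) [Field k] (n : ℕ) : Type u := T k n n

section

variable {k : Type u} [Field k] {n : ℕ}

/-- An element of `k((x₁))…((xₙ))((∂₁⁻¹))…((∂ᵣ₊₁⁻¹))` as a series in `∂ᵣ₊₁`. -/
def toOp {r : ℕ} (L : T k n (r + 1)) : Op (T k n r) ((tower k n r).d r) := L

/-- A series in `∂ᵣ₊₁` as an element of `k((x₁))…((xₙ))((∂₁⁻¹))…((∂ᵣ₊₁⁻¹))`. -/
def ofOp {r : ℕ} (L : Op (T k n r) ((tower k n r).d r)) : T k n (r + 1) := L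

/-- The embedding `k((x₁))…((xₙ)) → k((x₁))…((xₙ))((∂₁⁻¹))…((∂ᵣ⁻¹))`. -/
def ofK : (r : ℕ) → K k n → T k n r
  | 0, f => f
  | r + 1, f => ofOp (Op.const (ofK r f))

/-- The embedding of the constants `k → P`. -/
def constP (c : k) : P k n := ofK n (constK k n c)

/-- The elements of `k((x₁))…((xₙ))((∂₁⁻¹))…((∂ᵣ⁻¹))` all of whose coefficients lie in
`k[[x₁, …, xₙ]]`, that is, `k[[x₁, …, xₙ]]((∂₁⁻¹))…((∂ᵣ⁻¹))`. -/
def ET (k : Type u) [Field k] (n : ℕ) : (r : ℕ) → Set (T k n r)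
  | 0 => Set.range (taylor k n)
  | r + 1 => {L | ∀ i : ℤ, (toOp L).coeff i ∈ ET k n r}

/-- `E = k[[x₁, …, xₙ]]((∂₁⁻¹))…((∂ₙ⁻¹))`, as a subset of `P`. -/
def E (k : Type u) [Field k] (n : ℕ) : Set (P k n) := ET k n n

open scoped Classical in
/-- The order of an operator with respect to the last `∂ᵣ`: the order of `∑_{i ≤ m} aᵢ ∂ᵣⁱ` with
`aₘ ≠ 0` is `m`, and the order of `0` is `⊥ = -∞`.  (If there is no `∂` at all, nonzero elements
have order `0`.) -/
def ord : {r : ℕ} → T k n r → WithBot ℤ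
  | 0, L => if L = 0 then ⊥ else 0
  | _ + 1, L => if L = 0 then ⊥ else ((toOp L).top : WithBot ℤ)

/-- The coefficient `f ∈ k((x₁))…((xₙ))` in the highest term `f ∂₁^{m₁}…∂ᵣ^{mᵣ}`; it is `0` for the
zero operator. -/
def leadCoeff : {r : ℕ} → T k n r → K k n
  | 0, f => f
  | _ + 1, L => leadCoeff ((toOp L).coeff (toOp L).top)

/-- The exponents `(m₁, …, mᵣ)` of the highest term `f ∂₁^{m₁}…∂ᵣ^{mᵣ}` of a nonzero operator. -/
def expo : {r : ℕ} → T k n r → (Fin r → ℤ)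
  | 0, _ => Fin.elim0
  | _ + 1, L => Fin.snoc (α := fun _ => ℤ) (expo ((toOp L).coeff (toOp L).top)) (toOp L).top

open scoped Classical in
/-- `ν(L) = (m₁, …, mᵣ)` for `L ≠ 0`, and `ν(0) = ⊥ = -∞`.  The exponents are ordered
lexicographically, the exponent of the last `∂ᵣ`, which is the outermost variable, being compared
first; this is the order of `Colex`. -/
def nu {r : ℕ} (L : T k n r) : WithBot (Colex (Fin r → ℤ)) :=
  if L = 0 then ⊥ else (toColex (expo L) : Colex (Fin r → ℤ))

/-- The power `Lᵐ` formed from the product and the unit of `P`. -/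
def power (m : ℕ) (L : P k n) : P k n := npowRec m L

/-- `L` is invertible in the ring `E`. -/
def IsInvertibleInE (L : P k n) : Prop :=
  L ∈ E k n ∧ ∃ M ∈ E k n, L * M = 1 ∧ M * L = 1

end

end PsiDO

end

/-!
An operator in `r + 1` variables is a series in `∂ᵣ₊₁⁻¹` over the operators in `r` variables, so
everything is proved by induction on the number of variables, one step being a statement about
`A((∂⁻¹))` for a ring `A` with a derivation.

Associativity of `A((∂⁻¹))` is the Vandermonde identity for the monomials `a ∂ⁱ`
(`sum_choose_mul_choose`); it extends to all series since finite sums of monomials determine any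
given coefficient of a product (`hom_ext_of_single`). The derivations `∂/∂xᵢ` commute, so they
remain commuting derivations at the next stage (`BundledRing.IsDifferential.extend`).

The relation `IsLead L γ f`, "`L` is `f ∂^γ` plus terms with smaller exponents, `f` possibly zero",
is additive and multiplicative: derivatives only enter terms of smaller exponent, so highest terms
multiply as commuting monomials. Together with the fact that `K` is a field this gives the absence
of zero divisors, the rules for `ord` and `ν`, and the uniqueness of roots: if `Nᵐ = Mᵐ`, the
highest coefficients of `N` and `M` differ by an `m`-th root of unity of `K`, which lies in `k`;
after multiplication by this central constant they agree, and then `Nᵐ - Mᵐ = ∑ Nⁱ (N - M) Mᵐ⁻¹⁻ⁱ`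
has highest coefficient `m` times a nonzero product unless `N = M` (`eq_of_pow_eq_pow`).

Inverses and roots are constructed by successive approximation in the last `∂`
(`Op.exists_eq_of_approx`). Each correction solves a linear equation `∑ uᵢ c vᵢ = d` in one variable
less, whose highest terms add up to something nonzero; such equations are solvable by the same
method (`exists_sum_mul_mul_eq`). All constructions keep the coefficients in a subring `R` of `K`
that is stable under the `∂/∂xᵢ` and contains the inverses that occur; `R = K` gives the
statements on `P`, and `R = k[[x₁, …, xₙ]]` those on `E`.
-/

noncomputable section

namespace PsiDO

/-! ### The Leibniz product on `A((∂⁻¹))` -/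

namespace Op

section Basic

variable {A : Type u} [NonUnitalNonAssocRing A] {δ : A →+ A}

/-- The coefficient of `∂ⁱ`, as an additive map. -/
def coeffHom (i : ℤ) : Op A δ →+ A where
  toFun L := L.coeff i
  map_zero' := rfl
  map_add' _ _ := rfl

theorem sub_coeff (L M : Op A δ) (i : ℤ) : (L - M).coeff i = L.coeff i - M.coeff i :=
  map_sub (coeffHom i) L M

theorem sum_coeff {ι : Type*} (s : Finset ι) (f : ι → Op A δ) (i : ℤ) :
    (∑ x ∈ s, f x).coeff i = ∑ x ∈ s, (f x).coeff i :=
  map_sum (coeffHom i) f s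

/-- `L` has order at most `N`. -/
def OrdLE (L : Op A δ) (N : ℤ) : Prop := ∀ i, N < i → L.coeff i = 0

/-- The operator `a ∂ⁱ`. -/
def single (i : ℤ) (a : A) : Op A δ :=
  ⟨fun j => if j = i then a else 0, i, fun _ hj => if_neg (by omega)⟩

@[simp] theorem single_coeff_same (i : ℤ) (a : A) : (single i a : Op A δ).coeff i = a :=
  if_pos rfl

theorem single_coeff_of_ne {i j : ℤ} (h : j ≠ i) (a : A) : (single i a : Op A δ).coeff j = 0 :=
  if_neg h

theorem ordLE_single (i : ℤ) (a : A) : (single i a : Op A δ).OrdLE i :=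
  fun _ hj => single_coeff_of_ne (by omega) a

theorem OrdLE.add {L M : Op A δ} {N : ℤ} (hL : L.OrdLE N) (hM : M.OrdLE N) : (L + M).OrdLE N :=
  fun i hi => by rw [add_coeff, hL i hi, hM i hi, add_zero]

theorem OrdLE.mul {L M : Op A δ} {N₁ N₂ : ℤ} (hL : L.OrdLE N₁) (hM : M.OrdLE N₂) :
    (L * M).OrdLE (N₁ + N₂) := fun l hl =>
  finsum_eq_zero_of_forall_eq_zero fun p => by
    by_contra hp
    have := mulTerm_ne_zero hL hM hp
    omega

/-- The coefficient of the largest exponent that can occur in a product is the product of the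
coefficients: the terms with derivatives are of smaller order. -/
theorem mul_coeff_add {L M : Op A δ} {N₁ N₂ : ℤ} (hL : L.OrdLE N₁) (hM : M.OrdLE N₂) :
    (L * M).coeff (N₁ + N₂) = L.coeff N₁ * M.coeff N₂ := by
  rw [mul_coeff, finsum_eq_single _ ((N₁, 0) : ℤ × ℕ)]
  · simp [mulTerm]
  · rintro ⟨i, s⟩ hp
    by_contra h
    have := mulTerm_ne_zero hL hM h
    exact hp (Prod.ext (by simp at this ⊢; omega) (by simp at this ⊢; omega))

theorem finsum_eq_sum_range (F : ℤ × ℕ → A) (f : ℕ → ℤ) (n : ℕ)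
    (h : ∀ i s, F (i, s) ≠ 0 → i = f s ∧ s < n) :
    ∑ᶠ p, F p = ∑ s ∈ Finset.range n, F (f s, s) := by
  have hinj : Set.InjOn (fun s : ℕ => (f s, s)) (Finset.range n) := fun s _ t _ h => by
    simpa using congrArg Prod.snd h
  rw [finsum_eq_sum_of_support_subset (s := (Finset.range n).image fun s => (f s, s)),
    Finset.sum_image hinj]
  rintro ⟨i, s⟩ hp
  obtain ⟨rfl, hs⟩ := h i s hp
  exact Finset.mem_coe.2 (Finset.mem_image_of_mem (fun s => (f s, s)) (Finset.mem_range.2 hs))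

theorem single_mul_coeff (i : ℤ) (a : A) (M : Op A δ) (l : ℤ) (n : ℕ)
    (hn : ∀ s : ℕ, n ≤ s → M.coeff (l - i + s) = 0) :
    (single i a * M).coeff l =
      ∑ s ∈ Finset.range n, Ring.choose i s • (a * (δ^[s]) (M.coeff (l - i + s))) := by
  rw [mul_coeff, finsum_eq_sum_range _ (fun _ => i) n]
  · simp only [mulTerm, single_coeff_same]
  · intro i' s hp
    rw [mulTerm] at hp
    obtain rfl : i' = i := by
      by_contra hi
      exact hp (by rw [single_coeff_of_ne hi, zero_mul, smul_zero])
    refine ⟨rfl, ?_⟩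
    by_contra hs
    exact hp (by rw [hn s (not_lt.1 hs), iterate_delta_zero, mul_zero, smul_zero])

theorem mul_single_coeff (L : Op A δ) (j : ℤ) (b : A) (l : ℤ) (n : ℕ)
    (hn : ∀ s : ℕ, n ≤ s → L.coeff (l - j + s) = 0) :
    (L * single j b).coeff l =
      ∑ s ∈ Finset.range n, Ring.choose (l - j + s) s • (L.coeff (l - j + s) * (δ^[s]) b) := by
  rw [mul_coeff, finsum_eq_sum_range _ (fun s => l - j + s) n]
  · refine Finset.sum_congr rfl fun s _ => ?_
    rw [mulTerm, show l - (l - j + (s : ℤ), s).1 + ((l - j + (s : ℤ), s).2 : ℤ) = j by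
      dsimp only; ring,
      single_coeff_same]
  · intro i' s hp
    rw [mulTerm] at hp
    have hi : l - i' + s = j := by
      by_contra hi
      exact hp (by rw [single_coeff_of_ne hi, iterate_delta_zero, mul_zero, smul_zero])
    obtain rfl : i' = l - j + s := by omega
    refine ⟨rfl, ?_⟩
    by_contra hs
    exact hp (by rw [hn s (not_lt.1 hs), zero_mul, smul_zero])

theorem single_mul_single_coeff (i j : ℤ) (a b : A) (s : ℕ) :
    (single i a * single j b : Op A δ).coeff (i + j - s) =
      Ring.choose i s • (a * (δ^[s]) b) := by
  rw [single_mul_coeff i a _ _ (s + 1) fun t ht => single_coeff_of_ne (by omega) b,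
    Finset.sum_eq_single_of_mem s (by simp)]
  · rw [show i + j - s - i + s = j by ring, single_coeff_same]
  · intro t _ hts
    rw [single_coeff_of_ne (by omega), iterate_delta_zero, mul_zero, smul_zero]

theorem const_eq_single (a : A) : (const a : Op A δ) = single 0 a := rfl

theorem const_mul_coeff (a : A) (M : Op A δ) (l : ℤ) :
    (const a * M).coeff l = a * M.coeff l := by
  rw [mul_coeff, finsum_eq_single _ ((0, 0) : ℤ × ℕ)]
  · simp [mulTerm, const_eq_single]
  · rintro ⟨i, s⟩ hp
    by_cases hi : i = 0
    · subst hi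
      have hs : 0 < s := Nat.pos_of_ne_zero fun h => hp (by rw [h])
      rw [mulTerm, Ring.choose_zero_pos ℤ hs, zero_smul]
    · rw [mulTerm, const_eq_single, single_coeff_of_ne hi, zero_mul, smul_zero]

theorem mul_const_coeff (L : Op A δ) {b : A} (hb : δ b = 0) (l : ℤ) :
    (L * const b).coeff l = L.coeff l * b := by
  have hs : ∀ s : ℕ, s ≠ 0 → (δ^[s]) b = 0 := fun s h0 => by
    obtain ⟨t, rfl⟩ := Nat.exists_eq_succ_of_ne_zero h0
    rw [Function.iterate_succ_apply, hb, iterate_delta_zero]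
  rw [mul_coeff, finsum_eq_single _ ((l, 0) : ℤ × ℕ)]
  · simp [mulTerm, const_eq_single]
  · rintro ⟨i, s⟩ hp
    by_cases h0 : s = 0
    · subst h0
      have : l - i + ((0 : ℕ) : ℤ) ≠ 0 := fun h => hp (by rw [show i = l by simp at h; omega])
      rw [mulTerm, const_eq_single, single_coeff_of_ne this, iterate_delta_zero, mul_zero,
        smul_zero]
    · have : (δ^[s]) ((const b : Op A δ).coeff (l - i + s)) = 0 := by
        by_cases h : l - i + s = 0
        · rw [h, const_eq_single, single_coeff_same, hs s h0]
        · rw [const_eq_single, single_coeff_of_ne h, iterate_delta_zero]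
      rw [mulTerm, this, mul_zero, smul_zero]

/-- The coefficients of a product lie in an additive subgroup that contains the coefficients of
the factors and is closed under products and `δ`. -/
theorem mul_coeff_mem {S : AddSubgroup A} (hmul : ∀ a ∈ S, ∀ b ∈ S, a * b ∈ S)
    (hδ : ∀ a ∈ S, δ a ∈ S) {L M : Op A δ} (hL : ∀ i, L.coeff i ∈ S) (hM : ∀ i, M.coeff i ∈ S)
    (l : ℤ) : (L * M).coeff l ∈ S := by
  have hit : ∀ (s : ℕ) (b : A), b ∈ S → (δ^[s]) b ∈ S := fun s => by
    induction s with
    | zero => exact fun b hb => hb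
    | succ s ih => exact fun b hb => by rw [Function.iterate_succ_apply]; exact ih _ (hδ b hb)
  exact finsum_induction (· ∈ S) S.zero_mem (fun _ _ => S.add_mem) fun p =>
    S.zsmul_mem (hmul _ (hL _) _ (hit _ _ (hM _))) _

/-- An additive map of `A` that is a derivation and commutes with `δ` acts on `A((∂⁻¹))` as a
derivation. -/
theorem mapCoeff_mul (e : A →+ A) (he : ∀ a b, e (a * b) = e a * b + a * e b)
    (hc : ∀ a, e (δ a) = δ (e a)) (L M : Op A δ) :
    mapCoeff e (L * M) = mapCoeff e L * M + L * mapCoeff e M := by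
  have hit : ∀ (s : ℕ) (b : A), e ((δ^[s]) b) = (δ^[s]) (e b) := fun s => by
    induction s with
    | zero => exact fun b => rfl
    | succ s ih => exact fun b => by simp only [Function.iterate_succ_apply, ih, hc]
  ext l
  change e (∑ᶠ p, mulTerm L M l p) =
    ∑ᶠ p, mulTerm (mapCoeff e L) M l p + ∑ᶠ p, mulTerm L (mapCoeff e M) l p
  rw [AddMonoidHom.map_finsum e (mulTerm_finite L M l),
    ← finsum_add_distrib (mulTerm_finite _ _ l) (mulTerm_finite _ _ l)]
  refine finsum_congr fun p => ?_
  simp only [mulTerm, map_zsmul, he, hit, smul_add]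
  rfl

theorem exists_ordLE_sub_sum_single (L : Op A δ) (t : ℤ) :
    ∃ s : Finset ℤ, (L - ∑ i ∈ s, single i (L.coeff i)).OrdLE t := by
  obtain ⟨N, hN⟩ := L.bdd
  refine ⟨Finset.Ioc t N, fun j hj => ?_⟩
  rw [sub_coeff, sum_coeff]
  by_cases hjN : j ≤ N
  · rw [Finset.sum_eq_single_of_mem j (Finset.mem_Ioc.2 ⟨hj, hjN⟩)
      fun i _ hi => single_coeff_of_ne hi.symm _, single_coeff_same, sub_self]
  · rw [hN j (not_le.1 hjN), Finset.sum_eq_zero, sub_zero]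
    intro i hi
    exact single_coeff_of_ne (by have := (Finset.mem_Ioc.1 hi).2; omega) _

/-- The finite sums of operators `a ∂ⁱ` are dense: two additive maps that raise the order by a
bounded amount are equal when they agree on all `a ∂ⁱ`. -/
theorem hom_ext_of_single {B : Type*} [NonUnitalNonAssocRing B] {ε : B →+ B}
    {f g : Op A δ →+ Op B ε} {c : ℤ}
    (hf : ∀ L t, OrdLE L t → OrdLE (f L) (t + c)) (hg : ∀ L t, OrdLE L t → OrdLE (g L) (t + c))
    (h : ∀ i a, f (single i a) = g (single i a)) : f = g := by
  ext L l
  obtain ⟨s, hs⟩ := L.exists_ordLE_sub_sum_single (l - c - 1)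
  have hfin : f (∑ i ∈ s, single i (L.coeff i)) = g (∑ i ∈ s, single i (L.coeff i)) := by
    simp only [map_sum, h]
  have h₁ := hf _ _ hs l (by omega)
  have h₂ := hg _ _ hs l (by omega)
  rw [map_sub, sub_coeff, sub_eq_zero] at h₁ h₂
  rw [h₁, h₂, hfin]

end Basic

/-! ### Associativity -/

section Assoc

variable {A : Type u} [NonUnitalRing A] {δ : A →+ A}

/-- The identity of binomial coefficients behind associativity; it is the Vandermonde
convolution up to a common factor. -/
theorem sum_choose_mul_choose (i j : ℤ) (p q : ℕ) :
    ∑ x ∈ Finset.HasAntidiagonal.antidiagonal q,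
        Ring.choose i (p + x.1) * Ring.choose j x.2 * ((p + x.1).choose p : ℤ) =
      Ring.choose i p * Ring.choose (i + j - p) q := by
  rw [show i + j - (p : ℤ) = (i - p) + j by ring, Ring.add_choose_eq q (Commute.all _ _),
    Finset.mul_sum]
  refine Finset.sum_congr rfl fun x _ => ?_
  have := Ring.choose_smul_choose i (Nat.le_add_right p x.1)
  rw [Nat.add_sub_cancel_left, nsmul_eq_mul] at this
  linear_combination Ring.choose j x.2 * this

theorem iterate_delta_zsmul (s : ℕ) (z : ℤ) (a : A) : (δ^[s]) (z • a) = z • (δ^[s]) a := by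
  induction s generalizing a with
  | zero => rfl
  | succ s ih => rw [Function.iterate_succ_apply, map_zsmul, ih, Function.iterate_succ_apply]

theorem iterate_mul (hδ : ∀ a b, δ (a * b) = δ a * b + a * δ b) (s : ℕ) (a b : A) :
    (δ^[s]) (a * b) =
      ∑ x ∈ Finset.HasAntidiagonal.antidiagonal s, s.choose x.1 • ((δ^[x.1]) a * (δ^[x.2]) b) := by
  induction s with
  | zero => simp
  | succ s ih =>
    rw [Finset.sum_antidiagonal_choose_succ_nsmul (M := A)
      (fun i j => (δ^[i]) a * (δ^[j]) b) s, Function.iterate_succ_apply', ih, map_sum,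
      ← Finset.sum_add_distrib]
    refine Finset.sum_congr rfl fun x hx => ?_
    rw [map_nsmul, hδ, nsmul_add, Function.iterate_succ_apply', Function.iterate_succ_apply',
      add_comm, Nat.choose_symm_of_eq_add (Finset.HasAntidiagonal.mem_antidiagonal.1 hx).symm]

theorem sum_antidiagonal_assoc {M : Type*} [AddCommMonoid M] (f : ℕ → ℕ → ℕ → M) (w : ℕ) :
    ∑ x ∈ Finset.HasAntidiagonal.antidiagonal w,
        ∑ y ∈ Finset.HasAntidiagonal.antidiagonal x.1, f y.1 y.2 x.2 =
      ∑ x ∈ Finset.HasAntidiagonal.antidiagonal w,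
        ∑ y ∈ Finset.HasAntidiagonal.antidiagonal x.2, f x.1 y.1 y.2 := by
  rw [Finset.sum_sigma', Finset.sum_sigma']
  refine Finset.sum_nbij' (fun x => ⟨(x.2.1, x.2.2 + x.1.2), (x.2.2, x.1.2)⟩)
    (fun x => ⟨(x.1.1 + x.2.1, x.2.2), (x.1.1, x.2.1)⟩) ?_ ?_ ?_ ?_ ?_
  all_goals
    rintro ⟨⟨a, b⟩, ⟨c, d⟩⟩ h
    simp only [Finset.mem_sigma, Finset.HasAntidiagonal.mem_antidiagonal] at h ⊢
  · exact ⟨by omega, trivial⟩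
  · exact ⟨by omega, trivial⟩
  · obtain ⟨-, rfl⟩ := h; rfl
  · obtain ⟨-, rfl⟩ := h; rfl

theorem single_mul_single_mul_single_coeff (i j m : ℤ) (a b c : A) (w : ℕ) :
    (single i a * single j b * single m c : Op A δ).coeff (i + j + m - w) =
      ∑ x ∈ Finset.HasAntidiagonal.antidiagonal w,
        (Ring.choose i x.1 * Ring.choose (i + j - x.1) x.2) •
          (a * (δ^[x.1]) b * (δ^[x.2]) c) := by
  have hle := (ordLE_single (δ := δ) i a).mul (ordLE_single (δ := δ) j b)
  rw [mul_single_coeff _ _ _ _ (w + 1) fun s hs => hle _ (by omega),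
    ← Finset.Nat.sum_antidiagonal_swap, Finset.Nat.sum_antidiagonal_eq_sum_range_succ_mk]
  refine Finset.sum_congr rfl fun q hq => ?_
  have hq' : ((w - q : ℕ) : ℤ) = w - q := by
    have := Finset.mem_range.1 hq
    omega
  rw [show i + j + m - w - m + q = i + j - ((w - q : ℕ) : ℤ) by rw [hq']; ring,
    single_mul_single_coeff, smul_mul_assoc, smul_smul]
  simp only [Prod.swap, mul_comm]

theorem single_mul_single_mul_single_coeff' (hδ : ∀ a b, δ (a * b) = δ a * b + a * δ b)
    (i j m : ℤ) (a b c : A) (w : ℕ) :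
    (single i a * (single j b * single m c) : Op A δ).coeff (i + j + m - w) =
      ∑ x ∈ Finset.HasAntidiagonal.antidiagonal w,
        (Ring.choose i x.1 * Ring.choose (i + j - x.1) x.2) •
          (a * (δ^[x.1]) b * (δ^[x.2]) c) := by
  have hle := (ordLE_single (δ := δ) j b).mul (ordLE_single (δ := δ) m c)
  have hterm : (single i a * (single j b * single m c) : Op A δ).coeff (i + j + m - w) =
      ∑ x ∈ Finset.HasAntidiagonal.antidiagonal w,
        ∑ y ∈ Finset.HasAntidiagonal.antidiagonal x.1,
          (Ring.choose i (y.1 + y.2) * Ring.choose j x.2 * ((y.1 + y.2).choose y.1 : ℤ)) •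
            (a * (δ^[y.1]) b * (δ^[y.2 + x.2]) c) := by
    rw [single_mul_coeff _ _ _ _ (w + 1) fun s hs => hle _ (by omega),
      Finset.Nat.sum_antidiagonal_eq_sum_range_succ_mk]
    refine Finset.sum_congr rfl fun s hs => ?_
    have hs' : ((w - s : ℕ) : ℤ) = w - s := by
      have := Finset.mem_range.1 hs
      omega
    rw [show i + j + m - w - i + s = j + m - ((w - s : ℕ) : ℤ) by rw [hs']; ring,
      single_mul_single_coeff, iterate_delta_zsmul, iterate_mul hδ, mul_smul_comm, Finset.mul_sum,
      Finset.smul_sum, Finset.smul_sum]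
    refine Finset.sum_congr rfl fun y hy => ?_
    rw [Finset.HasAntidiagonal.mem_antidiagonal.1 hy, mul_smul_comm, ← natCast_zsmul, smul_smul,
      smul_smul, ← mul_assoc, Function.iterate_add_apply]
  rw [hterm, sum_antidiagonal_assoc (fun p r t => (Ring.choose i (p + r) * Ring.choose j t *
    ((p + r).choose p : ℤ)) • (a * (δ^[p]) b * (δ^[r + t]) c))]
  refine Finset.sum_congr rfl fun x _ => ?_
  rw [← sum_choose_mul_choose, Finset.sum_smul]
  refine Finset.sum_congr rfl fun y hy => ?_
  rw [Finset.HasAntidiagonal.mem_antidiagonal.1 hy]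

theorem mul_assoc_of_derivation (hδ : ∀ a b, δ (a * b) = δ a * b + a * δ b) (L M N : Op A δ) :
    L * M * N = L * (M * N) := by
  have hmono : ∀ i j m a b c,
      (single i a * single j b * single m c : Op A δ) = single i a * (single j b * single m c) := by
    intro i j m a b c
    ext l
    have hi := ordLE_single (δ := δ) i a
    have hj := ordLE_single (δ := δ) j b
    have hm := ordLE_single (δ := δ) m c
    rcases le_or_gt l (i + j + m) with h | h
    · obtain ⟨w, hw⟩ := Int.eq_ofNat_of_zero_le (sub_nonneg.2 h)
      obtain rfl : l = i + j + m - w := by omega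
      rw [single_mul_single_mul_single_coeff, single_mul_single_mul_single_coeff' hδ]
    · rw [(hi.mul hj).mul hm l h, hi.mul (hj.mul hm) l (by omega)]
  -- Linearity and density, applied to the three factors from right to left.
  have h₁ : ∀ i j a b N, (single i a * single j b * N : Op A δ) = single i a * (single j b * N) := by
    intro i j a b N
    have hi := ordLE_single (δ := δ) i a
    have hj := ordLE_single (δ := δ) j b
    refine DFunLike.congr_fun (hom_ext_of_single (c := i + j)
      (f := AddMonoidHom.mulLeft (single i a * single j b))
      (g := (AddMonoidHom.mulLeft (single i a)).comp (AddMonoidHom.mulLeft (single j b)))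
      (fun L t hL l hl => (hi.mul hj).mul hL l (by omega))
      (fun L t hL l hl => hi.mul (hj.mul hL) l (by omega)) fun m c => hmono i j m a b c) N
  have h₂ : ∀ i a M N, (single i a * M * N : Op A δ) = single i a * (M * N) := by
    intro i a M N
    have hi := ordLE_single (δ := δ) i a
    obtain ⟨n, hn⟩ := N.bdd
    refine DFunLike.congr_fun (hom_ext_of_single (c := i + n)
      (f := (AddMonoidHom.mulRight N).comp (AddMonoidHom.mulLeft (single i a)))
      (g := (AddMonoidHom.mulLeft (single i a)).comp (AddMonoidHom.mulRight N))
      (fun L t hL l hl => (hi.mul hL).mul hn l (by omega))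
      (fun L t hL l hl => hi.mul (hL.mul hn) l (by omega)) fun j b => h₁ i j a b N) M
  obtain ⟨n, hn : N.OrdLE n⟩ := N.bdd
  obtain ⟨m, hm : M.OrdLE m⟩ := M.bdd
  exact DFunLike.congr_fun (hom_ext_of_single (c := m + n)
    (f := (AddMonoidHom.mulRight N).comp (AddMonoidHom.mulRight M))
    (g := AddMonoidHom.mulRight (M * N))
    (fun L t hL l hl => (hL.mul hm).mul hn l (by omega))
    (fun L t hL l hl => hL.mul (hm.mul hn) l (by omega)) fun i a => h₂ i a M N) L

end Assoc

/-! ### Successive approximation -/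

section Approximation

variable {A : Type u} [NonUnitalNonAssocRing A] {δ : A →+ A}

/-- Solving `F c = d` coefficient by coefficient. If changing the coefficient of `∂ʲ` in `c`
(and anything below it) changes `F c` first at `∂^(j + γ)`, and there by `φ` of the change, with
`φ` surjective, then an approximate solution `c₀` can be corrected to a solution. The
coefficients are kept in a subset `S` on which `φ` is surjective. -/
theorem exists_eq_of_approx (S : AddSubgroup A) (F : Op A δ → Op A δ) (φ : A → A) (c₀ d : Op A δ)
    (j₀ γ : ℤ) (hc₀ : ∀ i, c₀.coeff i ∈ S) (hd : ∀ i, d.coeff i ∈ S)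
    (hFS : ∀ c : Op A δ, (∀ i, c.coeff i ∈ S) → (∀ i, j₀ < i → c.coeff i = c₀.coeff i) →
      ∀ i, (F c).coeff i ∈ S)
    (hφ : ∀ x ∈ S, ∃ y ∈ S, φ y = x)
    (hF : ∀ (c c' : Op A δ) (j : ℤ), j ≤ j₀ → (∀ i, j₀ < i → c.coeff i = c₀.coeff i) →
      (c' - c).OrdLE j →
        (∀ i, j + γ < i → (F c').coeff i = (F c).coeff i) ∧
        (F c').coeff (j + γ) = (F c).coeff (j + γ) + φ ((c' - c).coeff j))
    (h₀ : ∀ i, j₀ + γ < i → (F c₀).coeff i = d.coeff i) :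
    ∃ c : Op A δ, (∀ i, c.coeff i ∈ S) ∧ (∀ i, j₀ < i → c.coeff i = c₀.coeff i) ∧ F c = d := by
  classical
  -- The approximations that are correct above `∂^(j₀ - s + γ)`.
  let X (s : ℕ) : Type u := {c : Op A δ // (∀ i, c.coeff i ∈ S) ∧
    (∀ i, j₀ < i → c.coeff i = c₀.coeff i) ∧ ∀ i, j₀ - s + γ < i → (F c).coeff i = d.coeff i}
  have step : ∀ (s : ℕ) (c : X s), ∃ c' : X (s + 1),
      ∀ i, i ≠ j₀ - s → c'.1.coeff i = c.1.coeff i := by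
    rintro s ⟨c, hS, htop, hc⟩
    obtain ⟨y, hy, hyφ⟩ := hφ (d.coeff (j₀ - s + γ) - (F c).coeff (j₀ - s + γ))
      (S.sub_mem (hd _) (hFS c hS htop _))
    have hne : ∀ i, i ≠ j₀ - s → (c + single (j₀ - s) y).coeff i = c.coeff i := fun i hi => by
      rw [add_coeff, single_coeff_of_ne hi, add_zero]
    obtain ⟨h₁, h₂⟩ := hF c (c + single (j₀ - s) y) (j₀ - s) (by omega) htop
      (by rw [add_sub_cancel_left]; exact ordLE_single _ _)
    rw [add_sub_cancel_left, single_coeff_same, hyφ] at h₂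
    refine ⟨⟨c + single (j₀ - s) y, fun i => ?_, fun i hi => ?_, fun i hi => ?_⟩, hne⟩
    · by_cases h : i = j₀ - s
      · subst h
        rw [add_coeff, single_coeff_same]
        exact S.add_mem (hS _) hy
      · rw [hne i h]
        exact hS i
    · rw [hne i (by omega), htop i hi]
    · by_cases h : i = j₀ - s + γ
      · rw [h, h₂, add_sub_cancel]
      · rw [h₁ i (by push_cast at hi; omega), hc i (by push_cast at hi; omega)]
  choose next hnext using step
  let seq : (s : ℕ) → X s :=
    fun s => Nat.rec (motive := X) ⟨c₀, hc₀, fun _ _ => rfl, by simpa using h₀⟩ next s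
  have hstable : ∀ (s t : ℕ) (i : ℤ), s ≤ t → j₀ - s < i →
      (seq t).1.coeff i = (seq s).1.coeff i := by
    intro s t i hst hi
    induction t, hst using Nat.le_induction with
    | base => rfl
    | succ t hst ih => rw [← ih]; exact hnext t (seq t) i (by omega)
  obtain ⟨N, hN⟩ := c₀.bdd
  let c : Op A δ := ⟨fun i => (seq ((j₀ + 1 - i).toNat)).1.coeff i, max N j₀, fun i hi => by
    rw [(seq _).2.2.1 i (by omega), hN i (by omega)]⟩
  have hc : ∀ (s : ℕ) (i : ℤ), j₀ - s < i → c.coeff i = (seq s).1.coeff i := fun s i hi =>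
    (hstable _ s i (by omega) (by omega)).symm
  refine ⟨c, fun i => (seq _).2.1 i, fun i hi => (seq _).2.2.1 i hi, ?_⟩
  ext i
  have hs : j₀ - ((j₀ + γ + 1 - i).toNat : ℤ) + γ < i := by omega
  rw [← (seq _).2.2.2 i hs]
  refine (hF (seq _).1 c _ (by omega) (seq _).2.2.1 ?_).1 i hs
  intro l hl
  rw [sub_coeff, hc _ l hl, sub_self]

end Approximation

end Op

/-! ### The partial derivatives of `k((x₁))…((xₙ))` -/

/-- A map of Laurent series that acts on the coefficient of `xⁱ` by `e i` obeys the Leibniz rule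
when the `e i` do so jointly. -/
theorem laurent_leibniz {F : Type*} [Field F] (D : LaurentSeries F → LaurentSeries F)
    (e : ℤ → F →+ F) (hD : ∀ f i, (D f).coeff i = e i (f.coeff i))
    (he : ∀ i j a b, e (i + j) (a * b) = e i a * b + a * e j b) (f g : LaurentSeries F) :
    D (f * g) = D f * g + f * D g := by
  have hsupp : ∀ f, (D f).support ⊆ f.support := fun f i hi hf => hi (by simp [hD, hf])
  ext l
  rw [hD, HahnSeries.coeff_add, HahnSeries.coeff_mul_left' f.isPWO_support (hsupp f),
    HahnSeries.coeff_mul_right' g.isPWO_support (hsupp g), HahnSeries.coeff_mul, map_sum,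
    ← Finset.sum_add_distrib]
  refine Finset.sum_congr rfl fun x hx => ?_
  rw [← (Finset.mem_antidiagonal.1 hx).2.2, he, hD, hD]

theorem hasseDeriv_one_mul {F : Type*} [Field F] (f g : LaurentSeries F) :
    LaurentSeries.hasseDeriv F 1 (f * g) =
      LaurentSeries.hasseDeriv F 1 f * g + f * LaurentSeries.hasseDeriv F 1 g := by
  -- `x d/dx` multiplies the coefficient of `xⁱ` by `i`.
  let X : LaurentSeries F := HahnSeries.single 1 1
  have hX : X ≠ 0 := by simp [X]
  have h := laurent_leibniz (fun f => X * LaurentSeries.hasseDeriv F 1 f)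
    (fun i => zsmulAddGroupHom i) (fun f i => by
      have := HahnSeries.coeff_single_mul_add (r := (1 : F))
        (x := LaurentSeries.hasseDeriv F 1 f) (a := i - 1) (b := 1)
      rw [sub_add_cancel] at this
      simp [X, this])
    (fun i j a b => by simp; ring) f g
  refine mul_left_cancel₀ hX ?_
  rw [h]
  ring

section

variable (k : Type u) [Field k]

/-- `k((x₁))…((xₙ₊₁))` is the field of Laurent series over `k((x₁))…((xₙ))`. -/
def toLaurent (n : ℕ) : K k (n + 1) ≃+* LaurentSeries (K k n) := RingEquiv.refl _

variable {k} in
theorem K_ext {n : ℕ} {f g : K k (n + 1)}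
    (h : ∀ l, (toLaurent k n f).coeff l = (toLaurent k n g).coeff l) : f = g :=
  HahnSeries.ext (funext h)

theorem partialX_succ_self (n : ℕ) (f : K k (n + 1)) :
    toLaurent k n (partialX k (n + 1) n f) =
      LaurentSeries.hasseDeriv (K k n) 1 (toLaurent k n f) := by
  have h : partialX k (n + 1) n = ((LaurentSeries.hasseDeriv (K k n) 1 :
      LaurentSeries (K k n) →ₗ[K k n] LaurentSeries (K k n)).toAddMonoidHom :
      LaurentSeries (K k n) →+ LaurentSeries (K k n)) := if_pos rfl
  rw [h]
  rfl

theorem partialX_succ_self_coeff (n : ℕ) (f : K k (n + 1)) (l : ℤ) :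
    (toLaurent k n (partialX k (n + 1) n f)).coeff l =
      (l + 1) • (toLaurent k n f).coeff (l + 1) := by
  rw [partialX_succ_self, LaurentSeries.hasseDeriv_coeff]
  simp

theorem partialX_succ_of_ne_coeff {n i : ℕ} (h : i ≠ n) (f : K k (n + 1)) (l : ℤ) :
    (toLaurent k n (partialX k (n + 1) i f)).coeff l =
      partialX k n i ((toLaurent k n f).coeff l) := by
  have h : partialX k (n + 1) i =
      ({ toFun := fun f => HahnSeries.map f (partialX k n i)
         map_zero' := by ext; simp
         map_add' := fun f g => by ext; simp } :
        LaurentSeries (K k n) →+ LaurentSeries (K k n)) := if_neg h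
  rw [h]
  rfl

theorem partialX_mul (n i : ℕ) (f g : K k n) :
    partialX k n i (f * g) = partialX k n i f * g + f * partialX k n i g := by
  induction n with
  | zero => simp [partialX]
  | succ n ih =>
    apply (toLaurent k n).injective
    rw [map_add, map_mul (toLaurent k n) (partialX k (n + 1) i f),
      map_mul (toLaurent k n) f (partialX k (n + 1) i g)]
    by_cases h : i = n
    · subst h
      simp only [partialX_succ_self, map_mul]
      exact hasseDeriv_one_mul _ _
    · have := laurent_leibniz (fun f => toLaurent k n (partialX k (n + 1) i
        ((toLaurent k n).symm f))) (fun _ => partialX k n i)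
        (fun f l => by rw [partialX_succ_of_ne_coeff k h, RingEquiv.apply_symm_apply])
        (fun _ _ => ih) (toLaurent k n f) (toLaurent k n g)
      simpa only [map_mul, RingEquiv.symm_apply_apply] using this

theorem partialX_comm (n i j : ℕ) (f : K k n) :
    partialX k n i (partialX k n j f) = partialX k n j (partialX k n i f) := by
  induction n with
  | zero => rfl
  | succ n ih =>
    have key : ∀ i, i ≠ n → ∀ f : K k (n + 1), partialX k (n + 1) i (partialX k (n + 1) n f) =
        partialX k (n + 1) n (partialX k (n + 1) i f) := fun i hi f => K_ext fun l => by
      rw [partialX_succ_of_ne_coeff k hi, partialX_succ_self_coeff, partialX_succ_self_coeff,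
        partialX_succ_of_ne_coeff k hi, map_zsmul]
    by_cases hi : i = n <;> by_cases hj : j = n
    · rw [hi, hj]
    · rw [hi]
      exact (key j hj f).symm
    · rw [hj]
      exact key i hi f
    · refine K_ext fun l => ?_
      rw [partialX_succ_of_ne_coeff k hi, partialX_succ_of_ne_coeff k hj,
        partialX_succ_of_ne_coeff k hj, partialX_succ_of_ne_coeff k hi, ih]

end

/-! ### The ring structure of the tower -/

/-- `A` is an associative ring with unit on which the operators `d i` act as commuting
derivations. -/
structure BundledRing.IsDifferential (A : BundledRing.{u}) : Prop where
  mul_assoc : ∀ a b c : A.carrier, a * b * c = a * (b * c)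
  one_mul : ∀ a : A.carrier, 1 * a = a
  mul_one : ∀ a : A.carrier, a * 1 = a
  leibniz : ∀ (i : ℕ) (a b : A.carrier), A.d i (a * b) = A.d i a * b + a * A.d i b
  d_comm : ∀ (i j : ℕ) (a : A.carrier), A.d i (A.d j a) = A.d j (A.d i a)

theorem BundledRing.IsDifferential.d_one {A : BundledRing.{u}} (hA : A.IsDifferential) (i : ℕ) :
    A.d i 1 = 0 := by
  have h := hA.leibniz i 1 1
  rwa [hA.mul_one, hA.mul_one, hA.one_mul, left_eq_add] at h

theorem BundledRing.IsDifferential.extend {A : BundledRing.{u}} (hA : A.IsDifferential) (r : ℕ) :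
    (extend A r).IsDifferential where
  mul_assoc L M N :=
    letI : NonUnitalRing A.carrier := { A.ring with mul_assoc := hA.mul_assoc }
    Op.mul_assoc_of_derivation (δ := A.d r) (hA.leibniz r) L M N
  one_mul L := Op.ext (funext fun l =>
    (Op.const_mul_coeff (δ := A.d r) 1 L l).trans (hA.one_mul _))
  mul_one L := Op.ext (funext fun l =>
    (Op.mul_const_coeff (δ := A.d r) L (hA.d_one r) l).trans (hA.mul_one _))
  leibniz i L M := Op.mapCoeff_mul (A.d i) (hA.leibniz i) (hA.d_comm i r) L M
  d_comm i j L := Op.ext (funext fun l => hA.d_comm i j (Op.coeff L l))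

theorem isDifferential_tower (k : Type u) [Field k] (n r : ℕ) :
    (tower k n r).IsDifferential := by
  induction r with
  | zero =>
    exact ⟨mul_assoc (G := K k n), one_mul (M := K k n), mul_one (M := K k n), partialX_mul k n,
      partialX_comm k n⟩
  | succ r ih => exact ih.extend r

/-- `k((x₁))…((xₙ))((∂₁⁻¹))…((∂ᵣ⁻¹))` as an associative ring with unit. Its operations are by
definition those of `tower k n r`. The instance is scoped, so that outside the namespace the
operations are those of `tower k n r` syntactically. -/
scoped instance instRingT (k : Type u) [Field k] (n r : ℕ) : Ring (T k n r) :=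
  { (tower k n r).ring, (tower k n r).one with
    mul_assoc := (isDifferential_tower k n r).mul_assoc
    one_mul := (isDifferential_tower k n r).one_mul
    mul_one := (isDifferential_tower k n r).mul_one }

/-! ### Constants and roots of unity in `k((x₁))…((xₙ))` -/

section

variable (k : Type u) [Field k]

/-- The embedding `k → k((x₁))…((xₙ))` as a ring homomorphism. -/
def constHom : (n : ℕ) → k →+* K k n
  | 0 => RingHom.id k
  | n + 1 => (toLaurent k n).symm.toRingHom.comp (HahnSeries.C.comp (constHom n))

theorem constHom_apply (n : ℕ) (c : k) : constHom k n c = constK k n c := by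
  induction n with
  | zero => rfl
  | succ n ih =>
    change (toLaurent k n).symm (HahnSeries.C (constHom k n c)) = _
    rw [ih]
    rfl

theorem partialX_constHom (n i : ℕ) (c : k) : partialX k n i (constHom k n c) = 0 := by
  induction n with
  | zero => rfl
  | succ n ih =>
    have hc : toLaurent k n (constHom k (n + 1) c) = HahnSeries.C (constHom k n c) := rfl
    refine K_ext fun l => ?_
    rw [map_zero, HahnSeries.coeff_zero]
    by_cases h : i = n
    · rw [h, partialX_succ_self_coeff, hc]
      by_cases hl : l + 1 = 0
      · rw [hl, zero_smul]
      · rw [HahnSeries.C_apply, HahnSeries.coeff_single_of_ne hl, smul_zero]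
    · rw [partialX_succ_of_ne_coeff k h, hc, HahnSeries.C_apply]
      by_cases hl : l = 0
      · rw [hl, HahnSeries.coeff_single_same, ih]
      · rw [HahnSeries.coeff_single_of_ne hl, map_zero]

/-- A root of unity in `F((x))` of order prime to the characteristic is a constant. -/
theorem exists_C_eq_of_pow_eq_one {F : Type*} [Field F] {m : ℕ} (hm : (m : F) ≠ 0)
    {f : LaurentSeries F} (hf : f ^ m = 1) : ∃ a : F, f = HahnSeries.C a := by
  have hm0 : m ≠ 0 := by rintro rfl; simp at hm
  have hf0 : f ≠ 0 := by rintro rfl; simp [hm0] at hf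
  have hord : f.order = 0 := by
    have h := HahnSeries.order_pow f m
    rw [hf, HahnSeries.order_one, eq_comm, smul_eq_zero] at h
    exact h.resolve_left hm0
  obtain ⟨p, rfl⟩ : ∃ p : PowerSeries F, HahnSeries.ofPowerSeries ℤ F p = f := by
    refine ⟨f.powerSeriesPart, ?_⟩
    have h := LaurentSeries.single_order_mul_powerSeriesPart f
    rwa [hord, HahnSeries.single_zero_one, one_mul] at h
  have hp : p ^ m = 1 := by
    apply HahnSeries.ofPowerSeries_injective (Γ := ℤ)
    rw [map_pow, hf, map_one]
  have ha : PowerSeries.constantCoeff p ^ m = 1 := by rw [← map_pow, hp, map_one]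
  have ha0 : PowerSeries.constantCoeff p ≠ 0 := by
    intro h
    simp [h, hm0] at ha
  -- `p - p(0)` divides `pᵐ - p(0)ᵐ = 0`, and the cofactor has constant term `m p(0)ᵐ⁻¹ ≠ 0`.
  have h := (Commute.all p (PowerSeries.C (PowerSeries.constantCoeff p))).geom_sum₂_mul m
  rw [hp, ← map_pow, ha, map_one, sub_self] at h
  rcases mul_eq_zero.1 h with h | h
  · apply_fun PowerSeries.constantCoeff at h
    rw [map_sum, map_zero, Finset.sum_congr rfl (g := fun _ => PowerSeries.constantCoeff p ^ (m - 1))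
      fun i hi => by
        rw [map_mul, map_pow, map_pow, PowerSeries.constantCoeff_C, ← pow_add,
          show i + (m - 1 - i) = m - 1 by have := Finset.mem_range.1 hi; omega],
      Finset.sum_const, Finset.card_range, nsmul_eq_mul] at h
    exact absurd h (mul_ne_zero hm (pow_ne_zero _ ha0))
  · refine ⟨PowerSeries.constantCoeff p, ?_⟩
    rw [← HahnSeries.ofPowerSeries_C, ← sub_eq_zero.1 h]

theorem exists_constHom_eq_of_pow_eq_one {n m : ℕ} (hm : (m : k) ≠ 0) {f : K k n}
    (hf : f ^ m = 1) : ∃ ζ : k, ζ ^ m = 1 ∧ constHom k n ζ = f := by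
  induction n with
  | zero => exact ⟨f, hf, rfl⟩
  | succ n ih =>
    have hmK : (m : K k n) ≠ 0 := by
      rw [← map_natCast (constHom k n)]
      exact (map_ne_zero _).2 hm
    have hf' : toLaurent k n f ^ m = 1 := by rw [← map_pow, hf, map_one]
    obtain ⟨a, ha⟩ := exists_C_eq_of_pow_eq_one hmK hf'
    obtain ⟨ζ, hζ, hζa⟩ := ih (f := a) (by
      apply HahnSeries.C_injective (Γ := ℤ)
      rw [map_pow, ← ha, hf', map_one])
    refine ⟨ζ, hζ, (toLaurent k n).injective ?_⟩
    rw [ha, ← hζa]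
    rfl

/-! ### The embedding of `k[[x₁, …, xₙ]]` -/

/-- `(α, j)` as an exponent in `n + 1` variables. -/
def snocExp {n : ℕ} (α : Fin n →₀ ℕ) (j : ℕ) : Fin (n + 1) →₀ ℕ :=
  Finsupp.equivFunOnFinite.symm (Fin.snoc (α := fun _ => ℕ) α j)

/-- The first `n` entries of an exponent in `n + 1` variables. -/
def initExp {n : ℕ} (β : Fin (n + 1) →₀ ℕ) : Fin n →₀ ℕ :=
  Finsupp.equivFunOnFinite.symm (Fin.init (α := fun _ => ℕ) β)

theorem snocExp_initExp {n : ℕ} (β : Fin (n + 1) →₀ ℕ) :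
    snocExp (initExp β) (β (Fin.last n)) = β := by
  ext i
  exact congrFun (Fin.snoc_init_self (α := fun _ => ℕ) β) i

@[simp] theorem snocExp_last {n : ℕ} (α : Fin n →₀ ℕ) (j : ℕ) :
    snocExp α j (Fin.last n) = j := Fin.snoc_last (α := fun _ => ℕ) j α

@[simp] theorem initExp_snocExp {n : ℕ} (α : Fin n →₀ ℕ) (j : ℕ) :
    initExp (snocExp α j) = α := by
  ext i
  exact congrFun (Fin.init_snoc (α := fun _ => ℕ) j α) i

theorem snocExp_add {n : ℕ} (α α' : Fin n →₀ ℕ) (j j' : ℕ) :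
    snocExp α j + snocExp α' j' = snocExp (α + α') (j + j') := by
  ext i
  refine Fin.lastCases ?_ (fun i => ?_) i
  · simp
  · exact (congrArg₂ (· + ·) (Fin.snoc_castSucc (α := fun _ => ℕ) j α i)
      (Fin.snoc_castSucc (α := fun _ => ℕ) j' α' i)).trans
      (Fin.snoc_castSucc (α := fun _ => ℕ) (j + j') (⇑(α + α')) i).symm

variable {k}

/-- The coefficient of `x_{n+1}ʲ` of a power series in `x₁, …, xₙ₊₁`. -/
def slice {n : ℕ} (j : ℕ) (φ : MvPowerSeries (Fin (n + 1)) k) : MvPowerSeries (Fin n) k :=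
  fun α => MvPowerSeries.coeff (snocExp α j) φ

theorem coeff_slice {n : ℕ} (j : ℕ) (φ : MvPowerSeries (Fin (n + 1)) k) (α : Fin n →₀ ℕ) :
    MvPowerSeries.coeff α (slice j φ) = MvPowerSeries.coeff (snocExp α j) φ := rfl

theorem ext_slice {n : ℕ} {φ ψ : MvPowerSeries (Fin (n + 1)) k}
    (h : ∀ j, slice j φ = slice j ψ) : φ = ψ := by
  ext β
  rw [← snocExp_initExp β, ← coeff_slice, ← coeff_slice, h]

theorem slice_add {n : ℕ} (j : ℕ) (φ ψ : MvPowerSeries (Fin (n + 1)) k) :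
    slice j (φ + ψ) = slice j φ + slice j ψ := by
  ext α
  simp only [coeff_slice, map_add]

theorem slice_one {n : ℕ} (j : ℕ) :
    slice j (1 : MvPowerSeries (Fin (n + 1)) k) = if j = 0 then 1 else 0 := by
  ext α
  have h : snocExp α j = 0 ↔ α = 0 ∧ j = 0 := by
    constructor
    · intro h
      have h₁ := initExp_snocExp α j
      have h₂ := snocExp_last α j
      rw [h] at h₁ h₂
      exact ⟨h₁.symm.trans (by ext; rfl), h₂.symm⟩
    · rintro ⟨rfl, rfl⟩
      ext i
      refine Fin.lastCases (snocExp_last 0 0) (fun i => ?_) i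
      exact Fin.snoc_castSucc (α := fun _ => ℕ) 0 (⇑(0 : Fin n →₀ ℕ)) i
  classical
  rw [coeff_slice, MvPowerSeries.coeff_one, if_congr h rfl rfl]
  by_cases hj : j = 0 <;> simp [hj, MvPowerSeries.coeff_one]

theorem slice_mul {n : ℕ} (j : ℕ) (φ ψ : MvPowerSeries (Fin (n + 1)) k) :
    slice j (φ * ψ) =
      ∑ x ∈ Finset.HasAntidiagonal.antidiagonal j, slice x.1 φ * slice x.2 ψ := by
  classical
  ext α
  simp only [coeff_slice, map_sum, MvPowerSeries.coeff_mul]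
  rw [Finset.sum_sigma']
  refine Finset.sum_nbij'
    (fun β => ⟨(β.1 (Fin.last n), β.2 (Fin.last n)), (initExp β.1, initExp β.2)⟩)
    (fun y => (snocExp y.2.1 y.1.1, snocExp y.2.2 y.1.2)) ?_ ?_ ?_ ?_ ?_
  · rintro ⟨β, β'⟩ h
    rw [Finset.HasAntidiagonal.mem_antidiagonal] at h
    simp only [Finset.mem_sigma, Finset.HasAntidiagonal.mem_antidiagonal]
    dsimp only at h
    rw [← snocExp_initExp β, ← snocExp_initExp β', snocExp_add] at h
    constructor
    · simpa using congrArg (fun γ => γ (Fin.last n)) h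
    · simpa using congrArg initExp h
  · rintro ⟨⟨a, b⟩, ⟨c, d⟩⟩ h
    simp only [Finset.mem_sigma, Finset.HasAntidiagonal.mem_antidiagonal] at h ⊢
    rw [snocExp_add, h.1, h.2]
  · rintro ⟨β, β'⟩ _
    simp only [snocExp_initExp]
  · rintro ⟨⟨a, b⟩, ⟨c, d⟩⟩ _
    simp only [snocExp_last, initExp_snocExp]
  · rintro ⟨β, β'⟩ _
    simp only [snocExp_initExp]

theorem toLaurent_taylor {n : ℕ} (φ : MvPowerSeries (Fin (n + 1)) k) :
    toLaurent k n (taylor k (n + 1) φ) =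
      HahnSeries.ofPowerSeries ℤ (K k n) (PowerSeries.mk fun j => taylor k n (slice j φ)) := rfl

theorem toLaurent_taylor_coeff {n : ℕ} (φ : MvPowerSeries (Fin (n + 1)) k) (l : ℤ) :
    (toLaurent k n (taylor k (n + 1) φ)).coeff l =
      if l < 0 then 0 else taylor k n (slice l.natAbs φ) := by
  rw [toLaurent_taylor, PowerSeries.coeff_coe, PowerSeries.coeff_mk]

theorem taylor_add {n : ℕ} (φ ψ : MvPowerSeries (Fin n) k) :
    taylor k n (φ + ψ) = taylor k n φ + taylor k n ψ := by
  induction n with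
  | zero => exact map_add (MvPowerSeries.coeff (0 : Fin 0 →₀ ℕ)) φ ψ
  | succ n ih =>
    refine K_ext fun l => ?_
    rw [map_add, HahnSeries.coeff_add, toLaurent_taylor_coeff, toLaurent_taylor_coeff,
      toLaurent_taylor_coeff, slice_add, ih]
    split_ifs <;> simp

theorem taylor_zero (n : ℕ) : taylor k n 0 = 0 := by
  have h := taylor_add (k := k) (n := n) 0 0
  rwa [add_zero, left_eq_add] at h

theorem taylor_one (n : ℕ) : taylor k n 1 = 1 := by
  induction n with
  | zero => exact map_one (MvPowerSeries.constantCoeff (σ := Fin 0) (R := k))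
  | succ n ih =>
    apply (toLaurent k n).injective
    rw [map_one, toLaurent_taylor, ← map_one (HahnSeries.ofPowerSeries ℤ (K k n))]
    congr 1
    ext j
    rw [PowerSeries.coeff_mk, slice_one, PowerSeries.coeff_one]
    split_ifs
    exacts [ih, taylor_zero n]

theorem taylor_mul {n : ℕ} (φ ψ : MvPowerSeries (Fin n) k) :
    taylor k n (φ * ψ) = taylor k n φ * taylor k n ψ := by
  induction n with
  | zero => exact map_mul (MvPowerSeries.constantCoeff (σ := Fin 0) (R := k)) φ ψ
  | succ n ih =>
    apply (toLaurent k n).injective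
    rw [map_mul, toLaurent_taylor, toLaurent_taylor, toLaurent_taylor, ← map_mul]
    congr 1
    ext j
    rw [PowerSeries.coeff_mk, PowerSeries.coeff_mul, slice_mul]
    let t : MvPowerSeries (Fin n) k →+ K k n := ⟨⟨taylor k n, taylor_zero n⟩, taylor_add⟩
    change t _ = _
    rw [map_sum]
    refine Finset.sum_congr rfl fun x _ => ?_
    rw [PowerSeries.coeff_mk, PowerSeries.coeff_mk]
    exact ih _ _

variable (k) in
/-- The embedding `k[[x₁, …, xₙ]] → k((x₁))…((xₙ))` as a ring homomorphism. -/
def taylorHom (n : ℕ) : MvPowerSeries (Fin n) k →+* K k n where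
  toFun := taylor k n
  map_zero' := taylor_zero n
  map_one' := taylor_one n
  map_add' := taylor_add
  map_mul' := taylor_mul

theorem taylor_injective (n : ℕ) : Function.Injective (taylor k n) := by
  induction n with
  | zero =>
    intro φ ψ h
    ext α
    rw [Subsingleton.elim α 0]
    exact h
  | succ n ih =>
    intro φ ψ h
    refine ext_slice fun j => ih ?_
    have hj := toLaurent_taylor_coeff φ j
    have hneg : ¬(j : ℤ) < 0 := by omega
    rw [h, toLaurent_taylor_coeff, if_neg hneg, if_neg hneg] at hj
    exact hj.symm

theorem mem_range_taylorHom_succ {n : ℕ} {f : K k (n + 1)} :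
    f ∈ (taylorHom k (n + 1)).range ↔ ∀ l, (toLaurent k n f).coeff l ∈ (taylorHom k n).range ∧
      (l < 0 → (toLaurent k n f).coeff l = 0) := by
  constructor
  · rintro ⟨φ, rfl⟩ l
    change (toLaurent k n (taylor k (n + 1) φ)).coeff l ∈ _ ∧
      (l < 0 → (toLaurent k n (taylor k (n + 1) φ)).coeff l = 0)
    rw [toLaurent_taylor_coeff]
    refine ⟨?_, fun h => if_pos h⟩
    split_ifs
    exacts [zero_mem _, ⟨_, rfl⟩]
  · intro h
    choose φ hφ using fun l => (h l).1
    refine ⟨fun β => MvPowerSeries.coeff (initExp β) (φ (β (Fin.last n))), K_ext fun l => ?_⟩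
    refine (toLaurent_taylor_coeff _ l).trans ?_
    split_ifs with hl
    · exact ((h l).2 hl).symm
    · rw [← hφ l]
      refine congrArg (taylor k n) ?_
      ext α
      have hl' : ((l.natAbs : ℕ) : ℤ) = l := Int.natAbs_of_nonneg (not_lt.1 hl)
      change MvPowerSeries.coeff (initExp (snocExp α l.natAbs))
        (φ (snocExp α l.natAbs (Fin.last n) : ℕ)) = _
      rw [initExp_snocExp, snocExp_last, hl']

/-- Partial derivatives of power series are power series. -/
theorem partialX_mem_range_taylorHom {n : ℕ} (i : ℕ) {f : K k n}
    (hf : f ∈ (taylorHom k n).range) : partialX k n i f ∈ (taylorHom k n).range := by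
  induction n with
  | zero => exact zero_mem _
  | succ n ih =>
    rw [mem_range_taylorHom_succ] at hf ⊢
    intro l
    by_cases h : i = n
    · rw [h, partialX_succ_self_coeff]
      refine ⟨zsmul_mem (hf _).1 _, fun hl => ?_⟩
      rcases (show l + 1 = 0 ∨ l + 1 < 0 by omega) with h0 | h0
      · rw [h0, zero_smul]
      · rw [(hf _).2 h0, smul_zero]
    · rw [partialX_succ_of_ne_coeff k h]
      exact ⟨ih (hf l).1, fun hl => by rw [(hf l).2 hl, map_zero]⟩

end

namespace Op

variable {A : Type u} [NonUnitalNonAssocRing A] {δ : A →+ A}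

theorem top_eq {L : Op A δ} {N : ℤ} (h : L.OrdLE N) (hN : L.coeff N ≠ 0) : L.top = N :=
  IsGreatest.csSup_eq ⟨hN, fun i hi => by
    by_contra hc
    exact hi (h i (not_le.1 hc))⟩

theorem isGreatest_top {L : Op A δ} (hL : L ≠ 0) : IsGreatest {i | L.coeff i ≠ 0} L.top := by
  obtain ⟨N, hN⟩ := L.bdd
  have hne : {i : ℤ | L.coeff i ≠ 0}.Nonempty := by
    by_contra h
    rw [Set.not_nonempty_iff_eq_empty, Set.eq_empty_iff_forall_notMem] at h
    exact hL (Op.ext (funext fun i => not_not.1 (h i)))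
  have hbdd : BddAbove {i : ℤ | L.coeff i ≠ 0} := ⟨N, fun i hi => by
    by_contra hc
    exact hi (hN i (not_le.1 hc))⟩
  exact ⟨Int.csSup_mem hne hbdd, fun i hi => le_csSup hbdd hi⟩

theorem coeff_top_ne_zero {L : Op A δ} (hL : L ≠ 0) : L.coeff L.top ≠ 0 := (isGreatest_top hL).1

theorem ordLE_top {L : Op A δ} (hL : L ≠ 0) : L.OrdLE L.top := fun i hi => by
  by_contra hc
  exact absurd ((isGreatest_top hL).2 hc) (not_le.2 hi)

end Op

/-! ### Highest terms -/

section

variable {k : Type u} [Field k] {n : ℕ}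

/-- `IsLead L γ f` says that `L` is `f ∂₁^{γ₁}…∂ᵣ^{γᵣ}` plus terms with smaller exponents. The
coefficient `f` may vanish, so that for fixed `γ` the condition is additive in `(L, f)`. -/
def IsLead : {r : ℕ} → T k n r → (Fin r → ℤ) → K k n → Prop
  | 0, L, _, f => L = f
  | r + 1, L, γ, f => (toOp L).OrdLE (γ (Fin.last r)) ∧
      IsLead ((toOp L).coeff (γ (Fin.last r))) (Fin.init (α := fun _ => ℤ) γ) f

theorem isLead_zero {r : ℕ} (γ : Fin r → ℤ) : IsLead (0 : T k n r) γ 0 := by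
  induction r with
  | zero => rfl
  | succ r ih => exact ⟨fun _ _ => rfl, ih _⟩

theorem IsLead.add {r : ℕ} {L M : T k n r} {γ : Fin r → ℤ} {f g : K k n} (hL : IsLead L γ f)
    (hM : IsLead M γ g) : IsLead (L + M) γ (f + g) := by
  induction r with
  | zero => exact congrArg₂ (fun a b : K k n => a + b) hL hM
  | succ r ih => exact ⟨hL.1.add hM.1, ih hL.2 hM.2⟩

theorem IsLead.sum {r : ℕ} {ι : Type*} {s : Finset ι} {L : ι → T k n r} {γ : Fin r → ℤ}
    {f : ι → K k n} (h : ∀ i ∈ s, IsLead (L i) γ (f i)) :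
    IsLead (∑ i ∈ s, L i) γ (∑ i ∈ s, f i) := by
  classical
  induction s using Finset.induction_on with
  | empty => exact isLead_zero γ
  | insert i s hi ih =>
    rw [Finset.sum_insert hi, Finset.sum_insert hi]
    exact (h i (Finset.mem_insert_self i s)).add
      (ih fun j hj => h j (Finset.mem_insert_of_mem hj))

theorem IsLead.mul {r : ℕ} {L M : T k n r} {γ γ' : Fin r → ℤ} {f g : K k n} (hL : IsLead L γ f)
    (hM : IsLead M γ' g) : IsLead (L * M) (γ + γ') (f * g) := by
  induction r with
  | zero => exact congrArg₂ (fun a b : K k n => a * b) hL hM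
  | succ r ih =>
    refine ⟨hL.1.mul hM.1, ?_⟩
    have h := Op.mul_coeff_add hL.1 hM.1
    change IsLead ((toOp L * toOp M).coeff (γ (Fin.last r) + γ' (Fin.last r))) _ _
    rw [h]
    exact ih hL.2 hM.2

theorem isLead_ofK (r : ℕ) (f : K k n) : IsLead (ofK r f) (0 : Fin r → ℤ) f := by
  induction r with
  | zero => rfl
  | succ r ih => exact ⟨Op.ordLE_single 0 _, ih⟩

theorem ofK_one (r : ℕ) : ofK r (1 : K k n) = 1 := by
  induction r with
  | zero => rfl
  | succ r ih => exact congrArg (fun a => ofOp (Op.const a)) ih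

theorem isLead_one (r : ℕ) : IsLead (1 : T k n r) 0 1 :=
  ofK_one (k := k) (n := n) r ▸ isLead_ofK r 1

theorem IsLead.pow {r : ℕ} {L : T k n r} {γ : Fin r → ℤ} {f : K k n} (hL : IsLead L γ f) (m : ℕ) :
    IsLead (L ^ m) (m • γ) (f ^ m) := by
  induction m with
  | zero =>
    rw [pow_zero, pow_zero, zero_smul]
    exact isLead_one r
  | succ m ih =>
    rw [pow_succ, pow_succ, succ_nsmul]
    exact ih.mul hL

theorem IsLead.eq_of_ne_zero {r : ℕ} {L : T k n r} {γ : Fin r → ℤ} {f : K k n}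
    (h : IsLead L γ f) (hf : f ≠ 0) : L ≠ 0 ∧ expo L = γ ∧ leadCoeff L = f := by
  induction r with
  | zero => exact ⟨fun hL => hf (h.symm.trans hL), Subsingleton.elim _ _, h⟩
  | succ r ih =>
    obtain ⟨h₁, h₂, h₃⟩ := ih h.2
    have htop : (toOp L).top = γ (Fin.last r) := Op.top_eq h.1 h₁
    refine ⟨fun hL => h₁ (by rw [hL]; rfl), ?_, ?_⟩
    · rw [expo, htop, h₂]
      exact Fin.snoc_init_self (α := fun _ => ℤ) γ
    · rw [leadCoeff, htop, h₃]

theorem IsLead.ne_zero {r : ℕ} {L : T k n r} {γ : Fin r → ℤ} {f : K k n}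
    (h : IsLead L γ f) (hf : f ≠ 0) : L ≠ 0 := (h.eq_of_ne_zero hf).1

theorem isLead_expo {r : ℕ} (L : T k n r) (hL : L ≠ 0) :
    IsLead L (expo L) (leadCoeff L) ∧ leadCoeff L ≠ 0 := by
  induction r with
  | zero => exact ⟨rfl, hL⟩
  | succ r ih =>
    obtain ⟨h₁, h₂⟩ := ih ((toOp L).coeff (toOp L).top) (Op.coeff_top_ne_zero hL)
    refine ⟨⟨?_, ?_⟩, h₂⟩
    · rw [expo, Fin.snoc_last]
      exact Op.ordLE_top hL
    · rw [expo, Fin.snoc_last, Fin.init_snoc]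
      exact h₁

theorem leadCoeff_ne_zero {r : ℕ} {L : T k n r} (hL : L ≠ 0) : leadCoeff L ≠ 0 :=
  (isLead_expo L hL).2

scoped instance instNoZeroDivisorsT (r : ℕ) : NoZeroDivisors (T k n r) where
  eq_zero_or_eq_zero_of_mul_eq_zero {L M} h := by
    by_contra! hc
    obtain ⟨hL, hL0⟩ := isLead_expo L hc.1
    obtain ⟨hM, hM0⟩ := isLead_expo M hc.2
    exact (hL.mul hM).ne_zero (mul_ne_zero hL0 hM0) h

scoped instance instNontrivialT (r : ℕ) : Nontrivial (T k n r) :=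
  ⟨1, 0, (isLead_one r).ne_zero one_ne_zero⟩

/-! ### The order and the multi-order -/

theorem ord_mul {r : ℕ} (L M : T k n r) : ord (L * M) = ord L + ord M := by
  rcases eq_or_ne L 0 with rfl | hL
  · cases r <;> simp [ord]
  rcases eq_or_ne M 0 with rfl | hM
  · cases r <;> simp [ord]
  cases r with
  | zero => simp [ord, hL, hM]
  | succ r =>
    have h : (toOp (L * M)).top = (toOp L).top + (toOp M).top := by
      have hc := Op.mul_coeff_add (Op.ordLE_top (L := toOp L) hL) (Op.ordLE_top (L := toOp M) hM)
      refine Op.top_eq ((Op.ordLE_top hL).mul (Op.ordLE_top hM)) ?_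
      change (toOp L * toOp M).coeff _ ≠ 0
      rw [hc]
      exact mul_ne_zero (M₀ := T k n r) (Op.coeff_top_ne_zero hL) (Op.coeff_top_ne_zero hM)
    rw [ord, ord, ord, if_neg hL, if_neg hM, if_neg (mul_ne_zero hL hM), h]
    rfl

theorem ord_succ_le_iff {r : ℕ} {L : T k n (r + 1)} {N : ℤ} :
    ord L ≤ N ↔ (toOp L).OrdLE N := by
  rw [ord]
  split_ifs with hL
  · exact iff_of_true bot_le fun i _ => by rw [hL]; rfl
  · rw [WithBot.coe_le_coe]
    refine ⟨fun h i hi => Op.ordLE_top hL i (h.trans_lt hi), fun h => ?_⟩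
    by_contra hc
    exact Op.coeff_top_ne_zero hL (h _ (not_le.1 hc))

theorem ord_add_le {r : ℕ} (L M : T k n r) : ord (L + M) ≤ max (ord L) (ord M) := by
  cases r with
  | zero => by_cases hL : L = 0 <;> by_cases hM : M = 0 <;> simp [ord, hL, hM]; split_ifs <;> simp
  | succ r =>
    induction h : max (ord L) (ord M) with
    | bot =>
      rw [max_eq_bot] at h
      have h0 : ∀ L : T k n (r + 1), ord L = ⊥ → L = 0 := fun L hL => by
        by_contra hc
        rw [ord, if_neg hc] at hL
        exact WithBot.coe_ne_bot hL
      rw [h0 L h.1, h0 M h.2, add_zero, ord, if_pos rfl]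
    | coe N =>
      exact ord_succ_le_iff.2 ((ord_succ_le_iff.1 ((le_max_left _ _).trans h.le)).add
        (ord_succ_le_iff.1 ((le_max_right _ _).trans h.le)))

theorem toColex_lt_iff {r : ℕ} (α β : Fin (r + 1) → ℤ) :
    toColex α < toColex β ↔ α (Fin.last r) < β (Fin.last r) ∨ α (Fin.last r) = β (Fin.last r) ∧
      toColex (Fin.init (α := fun _ => ℤ) α) < toColex (Fin.init (α := fun _ => ℤ) β) := by
  constructor
  · rintro ⟨i, hi, hlt⟩
    induction i using Fin.lastCases with
    | last => exact Or.inl hlt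
    | cast i =>
      exact Or.inr ⟨hi _ (Fin.castSucc_lt_last i),
        i, fun j hj => hi _ (Fin.castSucc_lt_castSucc_iff.2 hj), hlt⟩
  · rintro (h | ⟨h, i, hi, hlt⟩)
    · exact ⟨Fin.last r, fun j hj => absurd hj (not_lt.2 (Fin.le_last j)), h⟩
    · refine ⟨i.castSucc, fun j hj => ?_, hlt⟩
      induction j using Fin.lastCases with
      | last => exact h
      | cast j => exact hi j (Fin.castSucc_lt_castSucc_iff.1 hj)

theorem toColex_le_iff {r : ℕ} (α β : Fin (r + 1) → ℤ) :
    toColex α ≤ toColex β ↔ α (Fin.last r) < β (Fin.last r) ∨ α (Fin.last r) = β (Fin.last r) ∧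
      toColex (Fin.init (α := fun _ => ℤ) α) ≤ toColex (Fin.init (α := fun _ => ℤ) β) := by
  have heq : toColex α = toColex β ↔ α (Fin.last r) = β (Fin.last r) ∧
      toColex (Fin.init (α := fun _ => ℤ) α) = toColex (Fin.init (α := fun _ => ℤ) β) := by
    refine ⟨fun h => ?_, fun h => ?_⟩
    · rw [toColex_inj.1 h]
      exact ⟨rfl, rfl⟩
    · rw [← Fin.snoc_init_self (α := fun _ => ℤ) α, ← Fin.snoc_init_self (α := fun _ => ℤ) β, h.1,
        toColex_inj.1 h.2]
  have hle : toColex (Fin.init (α := fun _ => ℤ) α) ≤ toColex (Fin.init (α := fun _ => ℤ) β) ↔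
      toColex (Fin.init (α := fun _ => ℤ) α) < toColex (Fin.init (α := fun _ => ℤ) β) ∨
        toColex (Fin.init (α := fun _ => ℤ) α) = toColex (Fin.init (α := fun _ => ℤ) β) :=
    le_iff_lt_or_eq
  refine le_iff_lt_or_eq.trans ((or_congr (toColex_lt_iff α β) heq).trans ?_)
  rw [hle]
  tauto

/-- `ν(L) ≤ γ` exactly when all terms of `L` have exponents `≤ γ`. -/
theorem nu_le_iff {r : ℕ} {L : T k n r} {γ : Fin r → ℤ} :
    nu L ≤ ((toColex γ : Colex (Fin r → ℤ)) : WithBot (Colex (Fin r → ℤ))) ↔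
      ∃ f, IsLead L γ f := by
  rcases eq_or_ne L 0 with rfl | hL
  · rw [nu, if_pos rfl]
    exact iff_of_true bot_le ⟨0, isLead_zero γ⟩
  rw [nu, if_neg hL, WithBot.coe_le_coe]
  induction r with
  | zero => exact iff_of_true (le_of_eq (Subsingleton.elim _ _)) ⟨L, rfl⟩
  | succ r ih =>
    have hc := Op.coeff_top_ne_zero (L := toOp L) hL
    rw [toColex_le_iff, expo, Fin.snoc_last, Fin.init_snoc, ih hc]
    constructor
    · rintro (h | ⟨h, f, hf⟩)
      · refine ⟨0, fun i hi => Op.ordLE_top hL i (h.trans hi), ?_⟩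
        rw [Op.ordLE_top (L := toOp L) hL _ h]
        exact isLead_zero _
      · exact ⟨f, h ▸ Op.ordLE_top hL, h ▸ hf⟩
    · rintro ⟨f, h₁, h₂⟩
      have hle : (toOp L).top ≤ γ (Fin.last r) := by
        by_contra hlt
        exact hc (h₁ _ (not_le.1 hlt))
      rcases hle.lt_or_eq with h | h
      · exact Or.inl h
      · exact Or.inr ⟨h, f, h ▸ h₂⟩

theorem nu_mul {r : ℕ} (L M : T k n r) : nu (L * M) = nu L + nu M := by
  rcases eq_or_ne L 0 with rfl | hL
  · simp [nu]
  rcases eq_or_ne M 0 with rfl | hM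
  · simp [nu]
  obtain ⟨h₁, hL0⟩ := isLead_expo L hL
  obtain ⟨h₂, hM0⟩ := isLead_expo M hM
  rw [nu, nu, nu, if_neg hL, if_neg hM, if_neg (mul_ne_zero hL hM),
    ((h₁.mul h₂).eq_of_ne_zero (mul_ne_zero hL0 hM0)).2.1]
  rfl

theorem nu_add_le {r : ℕ} (L M : T k n r) : nu (L + M) ≤ max (nu L) (nu M) := by
  induction h : max (nu L) (nu M) with
  | bot =>
    rw [max_eq_bot] at h
    have h0 : ∀ L : T k n r, nu L = ⊥ → L = 0 := fun L hL => by
      by_contra hc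
      rw [nu, if_neg hc] at hL
      exact WithBot.coe_ne_bot hL
    rw [h0 L h.1, h0 M h.2, add_zero, nu, if_pos rfl]
  | coe γ =>
    obtain ⟨f, hf⟩ := nu_le_iff (γ := ofColex γ) |>.1 ((le_max_left _ _).trans h.le)
    obtain ⟨g, hg⟩ := nu_le_iff (γ := ofColex γ) |>.1 ((le_max_right _ _).trans h.le)
    exact nu_le_iff (γ := ofColex γ) |>.2 ⟨f + g, hf.add hg⟩

end

section

variable {k : Type u} [Field k] {n : ℕ}

/-! ### Operators with coefficients in a subring -/

/-- The operators all of whose coefficients lie in the subring `R` of `k((x₁))…((xₙ))`, as an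
additive subgroup; it is closed under products when `R` is stable under the `∂/∂xᵢ`. -/
def coeffIn (R : Subring (K k n)) : (r : ℕ) → AddSubgroup (T k n r)
  | 0 => R.toAddSubgroup
  | r + 1 =>
    { carrier := {L | ∀ i : ℤ, (toOp L).coeff i ∈ coeffIn R r}
      zero_mem' := fun _ => zero_mem _
      add_mem' := fun hL hM i => add_mem (hL i) (hM i)
      neg_mem' := fun hL i => neg_mem (hL i) }

theorem mem_coeffIn_top {r : ℕ} (L : T k n r) : L ∈ coeffIn (⊤ : Subring (K k n)) r := by
  induction r with
  | zero => exact Subring.mem_top (R := K k n) L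
  | succ r ih => exact fun i => ih _

theorem mem_coeffIn_range {r : ℕ} {L : T k n r} :
    L ∈ coeffIn (taylorHom k n).range r ↔ L ∈ ET k n r := by
  induction r with
  | zero => exact Iff.rfl
  | succ r ih => exact forall_congr' fun i => ih

theorem ofK_mem_coeffIn {R : Subring (K k n)} (r : ℕ) {f : K k n} (hf : f ∈ R) :
    ofK r f ∈ coeffIn R r := by
  induction r with
  | zero => exact hf
  | succ r ih =>
    intro i
    change (if i = 0 then ofK r f else 0) ∈ coeffIn R r
    split_ifs
    exacts [ih, zero_mem _]

theorem one_mem_coeffIn (R : Subring (K k n)) (r : ℕ) : 1 ∈ coeffIn R r :=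
  ofK_one (k := k) (n := n) r ▸ ofK_mem_coeffIn r R.one_mem

theorem d_mem_coeffIn {R : Subring (K k n)} (hR : ∀ i, ∀ f ∈ R, partialX k n i f ∈ R) (i : ℕ)
    {r : ℕ} {L : T k n r} (hL : L ∈ coeffIn R r) : (tower k n r).d i L ∈ coeffIn R r := by
  induction r with
  | zero => exact hR i L hL
  | succ r ih => exact fun j => ih (hL j)

theorem mul_mem_coeffIn {R : Subring (K k n)} (hR : ∀ i, ∀ f ∈ R, partialX k n i f ∈ R)
    {r : ℕ} {L M : T k n r} (hL : L ∈ coeffIn R r) (hM : M ∈ coeffIn R r) :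
    L * M ∈ coeffIn R r := by
  induction r with
  | zero => exact R.mul_mem hL hM
  | succ r ih =>
    exact Op.mul_coeff_mem (L := toOp L) (M := toOp M) (fun a ha b hb => ih ha hb)
      (fun a ha => d_mem_coeffIn hR r ha) hL hM

theorem pow_mem_coeffIn {R : Subring (K k n)} (hR : ∀ i, ∀ f ∈ R, partialX k n i f ∈ R)
    {r : ℕ} {L : T k n r} (hL : L ∈ coeffIn R r) (m : ℕ) : L ^ m ∈ coeffIn R r := by
  induction m with
  | zero => exact pow_zero L ▸ one_mem_coeffIn R r
  | succ m ih => exact pow_succ L m ▸ mul_mem_coeffIn hR ih hL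

theorem leadCoeff_mem {R : Subring (K k n)} {r : ℕ} {L : T k n r} (hL : L ∈ coeffIn R r) :
    leadCoeff L ∈ R := by
  induction r with
  | zero => exact hL
  | succ r ih => exact ih (hL _)

/-! ### Linear equations and inverses -/

/-- The equation `∑ᵢ uᵢ c vᵢ = d` can be solved for `c` when all `uᵢ c vᵢ` have the same exponent
and their highest terms do not cancel: comparing coefficients of `∂ᵣ` leads to equations of the
same kind for one variable less. -/
theorem exists_sum_mul_mul_eq {R : Subring (K k n)} (hR : ∀ i, ∀ f ∈ R, partialX k n i f ∈ R)
    {ι : Type*} (s : Finset ι) {r : ℕ} {u v : ι → T k n r} {α β : ι → Fin r → ℤ} {γ : Fin r → ℤ}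
    {f g : ι → K k n} (hu : ∀ i ∈ s, IsLead (u i) (α i) (f i))
    (hv : ∀ i ∈ s, IsLead (v i) (β i) (g i)) (hγ : ∀ i ∈ s, α i + β i = γ)
    (hne : ∑ i ∈ s, f i * g i ≠ 0) (hinv : (∑ i ∈ s, f i * g i)⁻¹ ∈ R)
    (huR : ∀ i ∈ s, u i ∈ coeffIn R r) (hvR : ∀ i ∈ s, v i ∈ coeffIn R r)
    {d : T k n r} (hd : d ∈ coeffIn R r) :
    ∃ c ∈ coeffIn R r, ∑ i ∈ s, u i * c * v i = d := by
  induction r with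
  | zero =>
    refine ⟨HMul.hMul (α := K k n) (β := K k n) d (∑ i ∈ s, f i * g i)⁻¹, R.mul_mem hd hinv, ?_⟩
    have h : ∀ c : T k n 0, (∑ i ∈ s, u i * c * v i : T k n 0) =
        HMul.hMul (α := K k n) (β := K k n) c (∑ i ∈ s, f i * g i) := by
      intro c
      refine Eq.trans ?_ (Finset.mul_sum (R := K k n) s (fun i => f i * g i) c).symm
      refine Finset.sum_congr rfl fun i hi => ?_
      rw [show u i = f i from hu i hi, show v i = g i from hv i hi]
      exact (mul_right_comm (G := K k n) _ _ _).trans (mul_comm (G := K k n) _ _)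
    exact (h _).trans (inv_mul_cancel_right₀ (G₀ := K k n) hne d)
  | succ r ih =>
    obtain ⟨D, hD : (toOp d).OrdLE D⟩ := (toOp d).bdd
    let a (i : ι) : T k n r := (toOp (u i)).coeff (α i (Fin.last r))
    let b (i : ι) : T k n r := (toOp (v i)).coeff (β i (Fin.last r))
    have hlast : ∀ i ∈ s, α i (Fin.last r) + β i (Fin.last r) = γ (Fin.last r) := fun i hi =>
      congrFun (hγ i hi) _
    let F (c : Op (T k n r) ((tower k n r).d r)) : Op (T k n r) ((tower k n r).d r) :=
      ∑ i ∈ s, toOp (u i) * c * toOp (v i)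
    -- `F` is additive and raises the order in `∂ᵣ₊₁` by `γ (Fin.last r)`.
    have hsub : ∀ c c', F c' = F c + F (c' - c) := fun c c' => by
      simp only [F, ← Finset.sum_add_distrib, ← add_mul, ← mul_add, add_sub_cancel]
    have hOrd : ∀ (c : Op (T k n r) ((tower k n r).d r)) (j : ℤ), c.OrdLE j →
        (F c).OrdLE (j + γ (Fin.last r)) ∧
        (F c).coeff (j + γ (Fin.last r)) = ∑ i ∈ s, a i * c.coeff j * b i := by
      intro c j hc
      constructor
      · intro l hl
        rw [Op.sum_coeff]
        refine Finset.sum_eq_zero fun i hi => ?_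
        refine (((hu i hi).1.mul hc).mul (hv i hi).1) l ?_
        have := hlast i hi
        omega
      · rw [Op.sum_coeff]
        refine Finset.sum_congr rfl fun i hi => ?_
        rw [show j + γ (Fin.last r) = α i (Fin.last r) + j + β i (Fin.last r) by
          rw [← hlast i hi]; ring]
        rw [Op.mul_coeff_add ((hu i hi).1.mul hc) (hv i hi).1, Op.mul_coeff_add (hu i hi).1 hc]
    obtain ⟨c, hcR, -, hc⟩ := Op.exists_eq_of_approx (coeffIn R r) F
      (fun y => ∑ i ∈ s, a i * y * b i) 0 (toOp d) (D - γ (Fin.last r)) (γ (Fin.last r))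
      (fun _ => zero_mem _) hd
      (fun c hc _ i => by
        rw [Op.sum_coeff]
        exact sum_mem fun x hx =>
          mul_mem_coeffIn hR (mul_mem_coeffIn hR (huR x hx) (M := ofOp c) hc) (hvR x hx) i)
      (fun x hx => ih (γ := Fin.init (α := fun _ => ℤ) γ) (fun i hi => (hu i hi).2)
        (fun i hi => (hv i hi).2)
        (fun i hi => by rw [← hγ i hi]; rfl) (fun i hi => huR i hi _) (fun i hi => hvR i hi _) hx)
      (fun c c' j _ _ hcc' => by
        obtain ⟨h₁, h₂⟩ := hOrd _ _ hcc'
        rw [hsub c c']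
        refine ⟨fun i hi => ?_, ?_⟩
        · rw [Op.add_coeff, h₁ i hi, add_zero]
        · rw [Op.add_coeff, h₂])
      (fun i hi => by
        rw [hD i (by omega)]
        exact (hOrd 0 (D - γ (Fin.last r)) (fun _ _ => rfl)).1 i hi)
    exact ⟨ofOp c, hcR, hc⟩

theorem exists_inverse {R : Subring (K k n)} (hR : ∀ i, ∀ f ∈ R, partialX k n i f ∈ R) {r : ℕ}
    {L : T k n r} (hL : L ≠ 0) (hLR : L ∈ coeffIn R r) (hinv : (leadCoeff L)⁻¹ ∈ R) :
    ∃ M ∈ coeffIn R r, L * M = 1 ∧ M * L = 1 := by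
  have key : ∀ L : T k n r, L ≠ 0 → L ∈ coeffIn R r → (leadCoeff L)⁻¹ ∈ R →
      ∃ M ∈ coeffIn R r, L * M = 1 := by
    intro L hL hLR hinv
    obtain ⟨M, hM, h⟩ := exists_sum_mul_mul_eq hR {()} (u := fun _ => L) (v := fun _ => 1)
      (f := fun _ => leadCoeff L) (g := fun _ => 1) (β := fun _ => 0)
      (fun _ _ => (isLead_expo L hL).1) (fun _ _ => isLead_one r) (fun _ _ => add_zero _)
      (by simpa using leadCoeff_ne_zero hL) (by simpa using hinv) (fun _ _ => hLR)
      (fun _ _ => one_mem_coeffIn R r) (one_mem_coeffIn R r)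
    exact ⟨M, hM, by simpa using h⟩
  obtain ⟨M, hM, h⟩ := key L hL hLR hinv
  have hM0 : M ≠ 0 := right_ne_zero_of_mul (h.trans_ne one_ne_zero)
  obtain ⟨hL₁, hL₂⟩ := isLead_expo L hL
  obtain ⟨hM₁, hM₂⟩ := isLead_expo M hM0
  have hlead : leadCoeff L * leadCoeff M = 1 := by
    rw [← ((hL₁.mul hM₁).eq_of_ne_zero (mul_ne_zero hL₂ hM₂)).2.2, h]
    exact ((isLead_one r).eq_of_ne_zero one_ne_zero).2.2
  -- `M` has a right inverse as well, which has to be `L`.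
  obtain ⟨N, -, h'⟩ := key M hM0 hM (by
    rw [← eq_inv_of_mul_eq_one_left hlead]
    exact leadCoeff_mem hLR)
  exact ⟨M, hM, h, by rwa [left_inv_eq_right_inv h h']⟩

/-! ### Roots -/

theorem pow_sub_pow_eq_sum {A : Type*} [Ring A] (x y : A) (m : ℕ) :
    x ^ m - y ^ m = ∑ i ∈ Finset.range m, x ^ i * (x - y) * y ^ (m - 1 - i) := by
  induction m with
  | zero => simp
  | succ m ih =>
    rw [Finset.sum_range_succ, Nat.add_sub_cancel, Nat.sub_self, pow_zero, mul_one,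
      Finset.sum_congr rfl (g := fun i => x ^ i * (x - y) * y ^ (m - 1 - i) * y) fun i hi => by
        rw [mul_assoc _ _ y, ← pow_succ, show m - 1 - i + 1 = m - i by
          have := Finset.mem_range.1 hi; omega],
      ← Finset.sum_mul, ← ih, sub_mul, mul_sub, ← pow_succ, ← pow_succ]
    abel

theorem sum_pow_mul_pow {F : Type*} [Field F] (g : F) (m : ℕ) :
    ∑ i ∈ Finset.range m, g ^ i * g ^ (m - 1 - i) = m * g ^ (m - 1) := by
  rw [Finset.sum_congr rfl (g := fun _ => g ^ (m - 1)) fun i hi => by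
    rw [← pow_add, show i + (m - 1 - i) = m - 1 by have := Finset.mem_range.1 hi; omega]]
  simp

/-- Roots exist when the highest term has a root with invertible coefficient: the coefficients of
the root with respect to `∂ᵣ` are found one by one, the first by induction on `r`, the others from
linear equations `∑ᵢ bⁱ c bᵐ⁻¹⁻ⁱ = d`. -/
theorem exists_pow_eq {R : Subring (K k n)} (hR : ∀ i, ∀ f ∈ R, partialX k n i f ∈ R) {m : ℕ}
    (hm : (m : K k n) ≠ 0) (hmR : (m : K k n)⁻¹ ∈ R) {r : ℕ} {L : T k n r} {γ : Fin r → ℤ}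
    {g : K k n} (hL : IsLead L (m • γ) (g ^ m)) (hLR : L ∈ coeffIn R r) (hg : g ≠ 0)
    (hgR : g ∈ R) (hginv : g⁻¹ ∈ R) : ∃ M ∈ coeffIn R r, M ^ m = L ∧ IsLead M γ g := by
  have hm0 : m ≠ 0 := by rintro rfl; simp at hm
  induction r with
  | zero => exact ⟨ofK 0 g, hgR, ((isLead_ofK 0 g).pow m).trans hL.symm, rfl⟩
  | succ r ih =>
    obtain ⟨b, hbR, hb, hbg⟩ := ih hL.2 (hLR _)
    set q := γ (Fin.last r) with hq
    have hmq : (m • γ) (Fin.last r) = m * q := by simp [hq]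
    rw [hmq] at hb
    have hLtop : (toOp L).OrdLE (m * q) := hmq ▸ hL.1
    let A := Op (T k n r) ((tower k n r).d r)
    have hpow : ∀ c : T k n (r + 1), (toOp c).OrdLE q → (toOp c).coeff q = b → ∀ i : ℕ,
        (toOp (c ^ i)).OrdLE (i * q) ∧ (toOp (c ^ i)).coeff (i * q) = b ^ i := by
      intro c hc hcb i
      induction i with
      | zero =>
        simp only [pow_zero, Nat.cast_zero, zero_mul]
        exact ⟨Op.ordLE_single 0 1, rfl⟩
      | succ i ih =>
        have hi : ((i + 1 : ℕ) : ℤ) * q = i * q + q := by push_cast; ring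
        rw [hi, pow_succ, pow_succ]
        refine ⟨ih.1.mul hc, ?_⟩
        rw [← ih.2, ← hcb]
        exact Op.mul_coeff_add ih.1 hc
    have hsingle : ∀ c : T k n (r + 1), (∀ i, q - 1 < i →
        (toOp c).coeff i = (Op.single q b : A).coeff i) →
        (toOp c).OrdLE q ∧ (toOp c).coeff q = b := fun c hc =>
      ⟨fun i hi => by rw [hc i (by omega), Op.single_coeff_of_ne (by omega)],
        by rw [hc q (by omega), Op.single_coeff_same]⟩
    -- The approximation starts from `b ∂^q`, whose `m`-th power is correct in order `m q`; a change
    -- of order `j ≤ q - 1` keeps the highest term and is first felt at `j + (m - 1) q`.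
    obtain ⟨c, hcR, hctop, hc⟩ := Op.exists_eq_of_approx (coeffIn R r)
      (fun c : A => toOp (ofOp c ^ m))
      (fun y => ∑ i ∈ Finset.range m, b ^ i * y * b ^ (m - 1 - i)) (Op.single q b) (toOp L)
      (q - 1) ((m - 1 : ℕ) * q)
      (fun i => by
        change (if i = q then b else 0) ∈ coeffIn R r
        split_ifs
        exacts [hbR, zero_mem _])
      hLR
      (fun c hc _ i => pow_mem_coeffIn hR (L := ofOp c) hc m i)
      (fun x hx => exists_sum_mul_mul_eq hR (Finset.range m)
        (γ := (m - 1) • Fin.init (α := fun _ => ℤ) γ)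
        (fun i _ => hbg.pow i) (fun i _ => hbg.pow (m - 1 - i))
        (fun i hi => by
          rw [← add_smul, show i + (m - 1 - i) = m - 1 by have := Finset.mem_range.1 hi; omega]
          rfl)
        (by rw [sum_pow_mul_pow]; exact mul_ne_zero hm (pow_ne_zero _ hg))
        (by
          rw [sum_pow_mul_pow, mul_inv, ← inv_pow]
          exact R.mul_mem hmR (R.pow_mem hginv _))
        (fun i _ => pow_mem_coeffIn hR hbR i) (fun i _ => pow_mem_coeffIn hR hbR _) hx)
      (fun c c' j hj hctop hcc' => by
        obtain ⟨hc₁, hc₂⟩ := hsingle (ofOp c) hctop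
        obtain ⟨hc₁', hc₂'⟩ := hsingle (ofOp c') fun i hi => by
          rw [← hctop i hi]
          exact sub_eq_zero.1 ((Op.sub_coeff c' c i).symm.trans (hcc' i (by omega)))
        have hdiff : toOp (ofOp c' ^ m) = toOp (ofOp c ^ m) + ∑ i ∈ Finset.range m,
            toOp (ofOp c' ^ i) * (c' - c) * toOp (ofOp c ^ (m - 1 - i)) :=
          eq_add_of_sub_eq' (pow_sub_pow_eq_sum (ofOp c') (ofOp c) m)
        have hexp : ∀ i ∈ Finset.range m,
            j + ((m - 1 : ℕ) : ℤ) * q = i * q + j + ((m - 1 - i : ℕ) : ℤ) * q := fun i hi => by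
          have : ((m - 1 : ℕ) : ℤ) = i + ((m - 1 - i : ℕ) : ℤ) := by
            have := Finset.mem_range.1 hi
            omega
          rw [this]
          ring
        rw [hdiff]
        refine ⟨fun i hi => ?_, ?_⟩
        · rw [Op.add_coeff, Op.sum_coeff, Finset.sum_eq_zero, add_zero]
          intro x hx
          rw [hexp x hx] at hi
          exact (((hpow _ hc₁' hc₂' x).1.mul hcc').mul (hpow _ hc₁ hc₂ _).1) i hi
        · rw [Op.add_coeff, Op.sum_coeff]
          congr 1
          refine Finset.sum_congr rfl fun x hx => ?_
          rw [hexp x hx, Op.mul_coeff_add ((hpow _ hc₁' hc₂' x).1.mul hcc') (hpow _ hc₁ hc₂ _).1,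
            Op.mul_coeff_add (hpow _ hc₁' hc₂' x).1 hcc', (hpow _ hc₁' hc₂' x).2,
            (hpow _ hc₁ hc₂ _).2])
      (fun i hi => by
        have hs := hpow (ofOp (Op.single q b)) (Op.ordLE_single q b) (Op.single_coeff_same q b) m
        have hi' : (m : ℤ) * q ≤ i := by
          have : ((m - 1 : ℕ) : ℤ) = m - 1 := by omega
          rw [this] at hi
          linarith [sub_mul (m : ℤ) 1 q]
        rcases hi'.lt_or_eq with h | h
        · rw [hs.1 i h, hLtop i h]
        · rw [← h, hs.2, hb])
    obtain ⟨h₁, h₂⟩ := hsingle (ofOp c) hctop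
    exact ⟨ofOp c, hcR, hc, h₁, h₂.symm ▸ hbg⟩

/-- Two `m`-th roots with the same highest coefficient agree: `N ^ m - M ^ m` is a sum of operators
`Nⁱ (N - M) Mᵐ⁻¹⁻ⁱ` with the same highest term, and `m ≠ 0` in `k`. -/
theorem eq_of_pow_eq_pow {m : ℕ} (hm : (m : K k n) ≠ 0) {r : ℕ} {M N : T k n r} {γ : Fin r → ℤ}
    {g : K k n} (hg : g ≠ 0) (hM : IsLead M γ g) (hN : IsLead N γ g) (h : N ^ m = M ^ m) :
    N = M := by
  by_contra hne
  obtain ⟨hD, hD0⟩ := isLead_expo (N - M) (sub_ne_zero.2 hne)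
  have hsum := IsLead.sum (s := Finset.range m) (γ := (m - 1) • γ + expo (N - M))
    (L := fun i => N ^ i * (N - M) * M ^ (m - 1 - i))
    (f := fun i => leadCoeff (N - M) * (g ^ i * g ^ (m - 1 - i))) fun i hi => by
      have := ((hN.pow i).mul hD).mul (hM.pow (m - 1 - i))
      have he : i • γ + expo (N - M) + (m - 1 - i) • γ = (m - 1) • γ + expo (N - M) := by
        rw [add_right_comm, ← add_smul,
          show i + (m - 1 - i) = m - 1 by have := Finset.mem_range.1 hi; omega]
      rwa [he, mul_right_comm, mul_comm] at this
  rw [← Finset.mul_sum, sum_pow_mul_pow, ← pow_sub_pow_eq_sum, h, sub_self] at hsum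
  exact hsum.ne_zero (mul_ne_zero hD0 (mul_ne_zero hm (pow_ne_zero _ hg))) rfl

end

section

variable {k : Type u} [Field k] {n : ℕ}

/-! ### Constants of `P` and the set of all roots -/

theorem d_ofK_constHom (r i : ℕ) (c : k) : (tower k n r).d i (ofK r (constHom k n c)) = 0 := by
  induction r with
  | zero => exact partialX_constHom k n i c
  | succ r ih =>
    refine Op.ext (funext fun l => ?_)
    change (tower k n r).d i (if l = 0 then ofK r (constHom k n c) else 0) = 0
    split_ifs
    exacts [ih, map_zero _]

theorem ofK_constHom_mul_comm (r : ℕ) (c : k) (L : T k n r) :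
    ofK r (constHom k n c) * L = L * ofK r (constHom k n c) := by
  induction r with
  | zero => exact mul_comm (G := K k n) _ _
  | succ r ih =>
    refine Op.ext (funext fun l => ?_)
    exact (Op.const_mul_coeff _ (toOp L) l).trans ((ih _).trans
      (Op.mul_const_coeff (toOp L) (d_ofK_constHom r r c) l).symm)

theorem ofK_mul (r : ℕ) (f g : K k n) : (ofK r (f * g) : T k n r) = ofK r f * ofK r g := by
  induction r with
  | zero => rfl
  | succ r ih =>
    refine Op.ext (funext fun l => ?_)
    refine Eq.trans ?_ (Op.const_mul_coeff (ofK r f) (Op.const (ofK r g)) l).symm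
    change (if l = 0 then ofK r (f * g) else 0) = ofK r f * (if l = 0 then ofK r g else 0)
    split_ifs
    exacts [ih, (mul_zero _).symm]

theorem ofK_pow (r : ℕ) (f : K k n) (m : ℕ) : (ofK r (f ^ m) : T k n r) = ofK r f ^ m := by
  induction m with
  | zero => rw [pow_zero, pow_zero, ofK_one]
  | succ m ih => rw [pow_succ, pow_succ, ofK_mul, ih]

theorem natCast_K_ne_zero {m : ℕ} (hm : (m : k) ≠ 0) : (m : K k n) ≠ 0 := by
  rw [← map_natCast (constHom k n)]
  exact (map_ne_zero _).2 hm

/-- The highest coefficients of two `m`-th roots differ by an `m`-th root of unity of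
`k((x₁))…((xₙ))`, which is a constant and hence central, and a root is determined by its highest
coefficient. -/
theorem pow_eq_iff {m : ℕ} (hm : (m : k) ≠ 0) {r : ℕ} {L M : T k n r} (hL : L ≠ 0)
    (hM : M ^ m = L) (N : T k n r) :
    N ^ m = L ↔ ∃ ζ : k, ζ ^ m = 1 ∧ N = ofK r (constK k n ζ) * M := by
  have hm0 : m ≠ 0 := by rintro rfl; simp at hm
  have hmK : (m : K k n) ≠ 0 := natCast_K_ne_zero hm
  have hζ : ∀ ζ : k, ζ ^ m = 1 → (ofK r (constHom k n ζ) * M) ^ m = L := fun ζ h => by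
    rw [(show Commute _ _ from ofK_constHom_mul_comm r ζ M).mul_pow, ← ofK_pow, ← map_pow, h,
      map_one, ofK_one, one_mul, hM]
  constructor
  · intro hN
    have hne : ∀ M : T k n r, M ^ m = L → M ≠ 0 := by
      rintro _ h rfl
      exact hL (by rw [← h, zero_pow hm0])
    have hroot : ∀ M : T k n r, M ^ m = L →
        expo L = m • expo M ∧ leadCoeff L = leadCoeff M ^ m := fun M h => by
      obtain ⟨h₁, h₂⟩ := isLead_expo M (hne M h)
      rw [← h]
      exact ((h₁.pow m).eq_of_ne_zero (pow_ne_zero m h₂)).2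
    obtain ⟨hMl, hM0⟩ := isLead_expo M (hne M hM)
    obtain ⟨hNl, hN0⟩ := isLead_expo N (hne N hN)
    have hexpo : expo N = expo M := by
      have h := (hroot N hN).1.symm.trans (hroot M hM).1
      funext i
      have hi := congrFun h i
      simpa [hm0] using hi
    obtain ⟨ζ, h1, h2⟩ := exists_constHom_eq_of_pow_eq_one k hm
      (f := leadCoeff N / leadCoeff M) (by
        rw [div_pow, ← (hroot N hN).2, (hroot M hM).2, div_self (pow_ne_zero m hM0)])
    refine ⟨ζ, h1, ?_⟩
    rw [← constHom_apply]
    have hlead := (isLead_ofK r (constHom k n ζ)).mul hMl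
    rw [zero_add, show constHom k n ζ * leadCoeff M = leadCoeff N by
      rw [h2, div_mul_cancel₀ _ hM0]] at hlead
    exact eq_of_pow_eq_pow hmK hN0 hlead (hexpo ▸ hNl) (by rw [hN, hζ ζ h1])
  · rintro ⟨ζ, h, rfl⟩
    rw [← constHom_apply]
    exact hζ ζ h

/-! ### The subring `E`, inverses and roots in `P` and `E` -/

theorem inv_natCast_mem_range_taylorHom {m : ℕ} (hm : (m : k) ≠ 0) :
    (m : K k n)⁻¹ ∈ (taylorHom k n).range := by
  refine ⟨MvPowerSeries.C (m : k)⁻¹, eq_inv_of_mul_eq_one_left ?_⟩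
  rw [← map_natCast (taylorHom k n), ← map_mul, ← map_natCast (MvPowerSeries.C (σ := Fin n)),
    ← map_mul, inv_mul_cancel₀ hm, map_one, map_one]

theorem inv_mem_range_taylorHom {f : MvPowerSeries (Fin n) k} (hf : IsUnit f) :
    (taylor k n f)⁻¹ ∈ (taylorHom k n).range := by
  obtain ⟨h, hh⟩ := hf.exists_right_inv
  refine ⟨h, eq_inv_of_mul_eq_one_right ?_⟩
  exact (taylor_mul f h).symm.trans (by rw [hh, taylor_one])

theorem isLead_of_dvd_expo {m r : ℕ} {L : T k n r} (hL : L ≠ 0)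
    (hdvd : ∀ i, (m : ℤ) ∣ expo L i) : ∃ γ : Fin r → ℤ, IsLead L (m • γ) (leadCoeff L) := by
  choose γ hγ using hdvd
  have h : expo L = m • γ := by
    funext i
    rw [hγ]
    simp
  exact ⟨γ, h ▸ (isLead_expo L hL).1⟩

theorem isInvertibleInE_iff {L : P k n} (hL : L ∈ E k n) :
    IsInvertibleInE L ↔
      ∃ f : MvPowerSeries (Fin n) k, taylor k n f = leadCoeff L ∧ IsUnit f := by
  constructor
  · rintro ⟨-, M, hM, h, -⟩
    obtain ⟨hL₁, hL₂⟩ := isLead_expo L (left_ne_zero_of_mul (h.trans_ne one_ne_zero))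
    obtain ⟨hM₁, hM₂⟩ := isLead_expo M (right_ne_zero_of_mul (h.trans_ne one_ne_zero))
    obtain ⟨f, hf⟩ := leadCoeff_mem (mem_coeffIn_range.2 hL)
    obtain ⟨g, hg⟩ := leadCoeff_mem (mem_coeffIn_range.2 hM)
    have hlead : leadCoeff L * leadCoeff M = 1 := by
      rw [← ((hL₁.mul hM₁).eq_of_ne_zero (mul_ne_zero hL₂ hM₂)).2.2, h]
      exact ((isLead_one n).eq_of_ne_zero one_ne_zero).2.2
    refine ⟨f, hf, IsUnit.of_mul_eq_one g (taylor_injective n ?_)⟩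
    rw [taylor_mul, taylor_one, ← hlead, ← hf, ← hg]
    rfl
  · rintro ⟨f, hf, hunit⟩
    have hL0 : L ≠ 0 := by
      rintro rfl
      have h0 : leadCoeff (0 : P k n) = 0 := by
        have : ∀ r, leadCoeff (0 : T k n r) = 0 := fun r => by
          induction r with
          | zero => rfl
          | succ r ih => exact ih
        exact this n
      have : f = 0 := taylor_injective n (by rw [hf, h0, taylor_zero])
      exact hunit.ne_zero this
    obtain ⟨M, hM, h⟩ := exists_inverse (fun i f hf => partialX_mem_range_taylorHom i hf) hL0
      (mem_coeffIn_range.2 hL) (hf ▸ inv_mem_range_taylorHom hunit)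
    exact ⟨hL, M, mem_coeffIn_range.1 hM, h⟩

theorem exists_inverse_in_P {L : P k n} (hL : L ≠ 0) : ∃ M : P k n, L * M = 1 ∧ M * L = 1 := by
  obtain ⟨M, -, h⟩ := exists_inverse (R := ⊤) (fun _ _ _ => Subring.mem_top _) hL
    (mem_coeffIn_top L) (Subring.mem_top _)
  exact ⟨M, h⟩

theorem one_mem_E : (1 : P k n) ∈ E k n := mem_coeffIn_range.1 (one_mem_coeffIn _ n)

theorem sub_mem_E {L M : P k n} (hL : L ∈ E k n) (hM : M ∈ E k n) : L - M ∈ E k n :=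
  mem_coeffIn_range.1 (sub_mem (mem_coeffIn_range.2 hL) (mem_coeffIn_range.2 hM))

theorem mul_mem_E {L M : P k n} (hL : L ∈ E k n) (hM : M ∈ E k n) : L * M ∈ E k n :=
  mem_coeffIn_range.1 (mul_mem_coeffIn (fun i _ hf => partialX_mem_range_taylorHom i hf)
    (mem_coeffIn_range.2 hL) (mem_coeffIn_range.2 hM))

theorem exists_power_eq_in_P {m : ℕ} (hm : (m : k) ≠ 0) {L : P k n} (hL : L ≠ 0)
    (hdvd : ∀ i, (m : ℤ) ∣ expo L i) {g : K k n} (hg : g ^ m = leadCoeff L) :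
    ∃ M : P k n, power m M = L := by
  obtain ⟨γ, hγ⟩ := isLead_of_dvd_expo hL hdvd
  have hm0 : m ≠ 0 := by rintro rfl; simp at hm
  have hg0 : g ≠ 0 := by
    rintro rfl
    exact leadCoeff_ne_zero hL (by rw [← hg, zero_pow hm0])
  obtain ⟨M, -, hM, -⟩ := exists_pow_eq (R := ⊤) (fun _ _ _ => Subring.mem_top _)
    (natCast_K_ne_zero hm) (Subring.mem_top _) (hg ▸ hγ) (mem_coeffIn_top L) hg0
    (Subring.mem_top _) (Subring.mem_top _)
  exact ⟨M, hM⟩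

theorem exists_power_eq_in_E {m : ℕ} (hm : (m : k) ≠ 0) {L : P k n} (hLE : L ∈ E k n)
    (hL : L ≠ 0) (hdvd : ∀ i, (m : ℤ) ∣ expo L i) {g : MvPowerSeries (Fin n) k}
    (hg : taylor k n (g ^ m) = leadCoeff L) (hunit : IsUnit g) :
    ∃ M ∈ E k n, power m M = L := by
  obtain ⟨γ, hγ⟩ := isLead_of_dvd_expo hL hdvd
  have hpow : taylor k n g ^ m = leadCoeff L := (map_pow (taylorHom k n) g m).symm.trans hg
  have hg0 : taylor k n g ≠ 0 := (hunit.map (taylorHom k n)).ne_zero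
  obtain ⟨M, hME, hM, -⟩ := exists_pow_eq (fun i _ hf => partialX_mem_range_taylorHom i hf)
    (natCast_K_ne_zero hm) (inv_natCast_mem_range_taylorHom hm) (hpow ▸ hγ)
    (mem_coeffIn_range.2 hLE) hg0 ⟨g, rfl⟩ (inv_mem_range_taylorHom hunit)
  exact ⟨M, mem_coeffIn_range.1 hME, hM⟩

theorem power_eq_iff {m : ℕ} (hm : (m : k) ≠ 0) {L M : P k n} (hL : L ≠ 0) (hM : power m M = L)
    (N : P k n) : power m N = L ↔ ∃ ζ : k, ζ ^ m = 1 ∧ N = constP ζ * M :=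
  pow_eq_iff hm hL hM N

end
end PsiDO

end

theorem proposition1 (k : Type u) [Field k] (n : ℕ) :
    -- i) `P` is an associative skew-field
    ((∀ L M N : PsiDO.P k n, (L * M) * N = L * (M * N)) ∧
      (∀ L : PsiDO.P k n, 1 * L = L ∧ L * 1 = L) ∧
      (1 : PsiDO.P k n) ≠ 0 ∧
      (∀ L : PsiDO.P k n, L ≠ 0 → ∃ M : PsiDO.P k n, L * M = 1 ∧ M * L = 1)) ∧
    -- `E` is a subring of `P`
    ((1 : PsiDO.P k n) ∈ PsiDO.E k n ∧
      ∀ L ∈ PsiDO.E k n, ∀ M ∈ PsiDO.E k n, L - M ∈ PsiDO.E k n ∧ L * M ∈ PsiDO.E k n) ∧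
    -- the units of `E`
    (∀ L ∈ PsiDO.E k n,
      PsiDO.IsInvertibleInE L ↔
        ∃ f : MvPowerSeries (Fin n) k, PsiDO.taylor k n f = PsiDO.leadCoeff L ∧ IsUnit f) ∧
    -- ii) the order
    (∀ L M : PsiDO.P k n, PsiDO.ord (L * M) = PsiDO.ord L + PsiDO.ord M ∧
      PsiDO.ord (L + M) ≤ max (PsiDO.ord L) (PsiDO.ord M)) ∧
    -- iii) the multi-order
    (∀ L M : PsiDO.P k n, PsiDO.nu (L * M) = PsiDO.nu L + PsiDO.nu M ∧
      PsiDO.nu (L + M) ≤ max (PsiDO.nu L) (PsiDO.nu M)) ∧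
    -- iv) roots in `P`
    (∀ m : ℕ, (m : k) ≠ 0 → ∀ L : PsiDO.P k n, L ≠ 0 → (∀ i, (m : ℤ) ∣ PsiDO.expo L i) →
      (∃ g : PsiDO.K k n, g ^ m = PsiDO.leadCoeff L) →
      ∃ M : PsiDO.P k n, PsiDO.power m M = L ∧
        ∀ N : PsiDO.P k n, PsiDO.power m N = L ↔
          ∃ ζ : k, ζ ^ m = 1 ∧ N = PsiDO.constP ζ * M) ∧
    -- iv) roots in `E`
    (∀ m : ℕ, (m : k) ≠ 0 → ∀ L ∈ PsiDO.E k n, L ≠ 0 → (∀ i, (m : ℤ) ∣ PsiDO.expo L i) →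
      ∀ g : MvPowerSeries (Fin n) k, PsiDO.taylor k n (g ^ m) = PsiDO.leadCoeff L →
        (IsUnit g → ∃ M ∈ PsiDO.E k n, PsiDO.power m M = L) ∧
        (∀ M ∈ PsiDO.E k n, PsiDO.power m M = L →
          ∀ N ∈ PsiDO.E k n, PsiDO.power m N = L ↔
            ∃ ζ : k, ζ ^ m = 1 ∧ N = PsiDO.constP ζ * M)) := by
  refine ⟨⟨(PsiDO.isDifferential_tower k n n).mul_assoc,
      fun L => ⟨(PsiDO.isDifferential_tower k n n).one_mul L,
        (PsiDO.isDifferential_tower k n n).mul_one L⟩,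
      ((PsiDO.isLead_one n).ne_zero one_ne_zero), fun L hL => PsiDO.exists_inverse_in_P hL⟩,
    ⟨PsiDO.one_mem_E, fun L hL M hM => ⟨PsiDO.sub_mem_E hL hM, PsiDO.mul_mem_E hL hM⟩⟩,
    fun L hL => PsiDO.isInvertibleInE_iff hL,
    fun L M => ⟨PsiDO.ord_mul L M, PsiDO.ord_add_le L M⟩,
    fun L M => ⟨PsiDO.nu_mul L M, PsiDO.nu_add_le L M⟩, ?_,
    fun m hm L hLE hL hdvd g hg => ⟨PsiDO.exists_power_eq_in_E hm hLE hL hdvd hg,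
      fun M _ hM N _ => PsiDO.power_eq_iff hm hL hM N⟩⟩
  rintro m hm L hL hdvd ⟨g, hg⟩
  obtain ⟨M, hM⟩ := PsiDO.exists_power_eq_in_P hm hL hdvd hg
  exact ⟨M, hM, PsiDO.power_eq_iff hm hL hM⟩
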